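/- **Setting.** Let $S$ be a compact oriented smooth surface with boundary, $\varphi:S\to S$ an orientation-preserving diffeomorphism that fixes $\partial S$ pointwise, and $a_1,\dots,a_N$ pairwise disjoint, properly embedded oriented arcs on $S$ that cut $S$ into a disjoint union of disks. For each $i$ let $b_i$ be a small isotopic copy of $a_i$ (with end points moving in $\partial S$): in an oriented tubular neighbourhood $[0,1]\times\mathbb{R}$ of $a_i=[0,1]\times\{0\}$, the neighbourhoods being pairwise disjoint, $b_i$ is the graph of a smooth function $f_i$ on $[0,1]$ with exactly one zero, which lies in $(0,1)$ and at which $f_i'>0$. So $b_i$ meets $a_i$ in exactly one interior point, positively. The thin strips between $a_i$ and $b_i$ are the set of points of the neighbourhood that lie between $a_i$ and the graph of $f_i$. Assume that the arcs $a_i$ and $\varphi(b_j)$ intersect transversely for all $i,j$. Let $\Sigma=S_{1/2}\cup_{\partial S}(-S_0)$ be the closed oriented surface obtained by gluing two copies of $S$ along the boundary, where the second has the reversed orientation. Let $\alpha_i=a_i\cup -a_i$ and $\beta_i=b_i\cup-\varphi(b_i)$, where the first part of each curve lies in $S_{1/2}$ and the second in $-S_0$. The point $x_\xi^i\in a_i\cap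 b_i\subset S_{1/2}$ is called the $i$-th contact intersection point. Choose one basepoint in the interior of each connected component of $S_{1/2}\setminus\bigcup_i a_i$, outside the thin strips between $a_i$ and $b_i$. A region is the closure of a connected component of $\Sigma\setminus\bigcup_i(\alpha_i\cup\beta_i)$; it is unpointed if that component contains no basepoint. A generator is a set of $N$ intersection points of $\alpha$- and $\beta$-curves that has exactly one point on each $\alpha_i$ and exactly one point on each $\beta_j$. For generators $\mathbf{x},\mathbf{y}$, let $\widehat{\pi}_2(\mathbf{x},\mathbf{y})$ be the set of formal integer linear combinations $D$ of unpointed regions with $\partial(\partial|_{\boldsymbol\beta}D)=\mathbf{y}-\mathbf{x}$, where $\partial|_{\boldsymbol\beta}D$ is the part of the 1-chain $\partial D$ that lies on the $\beta$-curves, and $\mathbf{x}$, $\mathbf{y}$ are regarded as 0-chains. Such a $D$ is positive if all its coefficients are non-negative. **Lemma.** Let $\mathbf{x},\mathbf{y}$ be generators with $\widehat{\pi}_2(\mathbf{x},\mathbf{y})\neq\emptyset$, and let $k$ be the number of contact intersection points that are in $\mathbf{y}$ but not in $\mathbf{x}$. Then $\widehat{\pi}_2(\mathbf{x},\mathbf{y})$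 contains at most $2^k$ positive domains (in particular, only finitely many). -/

import Mathlib

open Set Filter Topology Manifold
open scoped ContDiff

noncomputable section

namespace OpenBook

/-- The Euclidean plane. -/
abbrev Plane : Type := EuclideanSpace ℝ (Fin 2)

/-- The determinant of the pair `(v, w)` of vectors of the plane. -/
def det2 (v w : Plane) : ℝ := v 0 * w 1 - v 1 * w 0

section Surface

variable (S : Type*) [TopologicalSpace S] [ChartedSpace (EuclideanHalfSpace 2) S]

/-- The preferred charts of the surface `S` define an orientation: all the coordinate changes
between them have positive Jacobian determinant.  The tangent spaces of `S` are then oriented by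
their identification with the plane through the preferred charts. -/
def IsOriented : Prop :=
  ∀ p q r : S, r ∈ (chartAt (EuclideanHalfSpace 2) p).source →
    r ∈ (chartAt (EuclideanHalfSpace 2) q).source →
    0 < (fderivWithin ℝ (extChartAt (𝓡∂ 2) q ∘ (extChartAt (𝓡∂ 2) p).symm)
      (range (𝓡∂ 2)) (extChartAt (𝓡∂ 2) p r)).det

/-- The boundary `∂S`. -/
abbrev bd : Set S := (𝓡∂ 2).boundary S

/-- Two copies of `S` are glued along `∂S`. -/
def doubleSetoid : Setoid (S ⊕ S) where
  r x y := x = y ∨ (Sum.elim id id x = Sum.elim id id y ∧ Sum.elim id id x ∈ bd S)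
  iseqv :=
    { refl := fun _ => Or.inl rfl
      symm := by
        rintro x y (h | ⟨h, hb⟩)
        · exact Or.inl h.symm
        · exact Or.inr ⟨h.symm, h ▸ hb⟩
      trans := by
        rintro x y z (rfl | ⟨h, hb⟩) (rfl | ⟨h', hb'⟩)
        · exact Or.inl rfl
        · exact Or.inr ⟨h', hb'⟩
        · exact Or.inr ⟨h, hb⟩
        · exact Or.inr ⟨h.trans h', hb⟩ }

/-- The closed surface `Σ = S_{1/2} ∪ -S_0`, with the quotient topology. -/
abbrev Double : Type _ := Quotient (doubleSetoid S)

end Surface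

/-- The two pages `S_{1/2}` and `S_0` of which the Heegaard surface consists. -/
inductive Page where
  | half : Page
  | zero : Page

/-- The orientation of `Σ` is that of `S` on `S_{1/2}` and the opposite one on `S_0`. -/
def Page.sign : Page → ℤ
  | .half => 1
  | .zero => -1

section Diagram

variable {S : Type*} [TopologicalSpace S] [ChartedSpace (EuclideanHalfSpace 2) S]

/-- The inclusion of a page in the Heegaard surface. -/
def Page.incl : Page → S → Double S
  | .half, p => Quotient.mk _ (Sum.inl p)
  | .zero, p => Quotient.mk _ (Sum.inr p)

/-- The velocity of a curve in `S`, read in the preferred chart at the point. -/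
def velocity (γ : ℝ → S) (t : ℝ) : Plane :=
  (mfderiv 𝓘(ℝ, ℝ) (𝓡∂ 2) γ t : ℝ →L[ℝ] Plane) 1

variable (S) in
/-- An open book diagram `(S, φ, {a_1, …, a_N})`: an abstract open book together with pairwise
disjoint properly embedded oriented arcs that cut the page into disks. -/
structure OpenBookDiagram (N : ℕ) where
  /-- the monodromy -/
  φ : S ≃ₘ^∞⟮𝓡∂ 2, 𝓡∂ 2⟯ S
  φ_boundary : ∀ p ∈ bd S, φ p = p
  φ_orient : ∀ p : S, 0 < (mfderiv (𝓡∂ 2) (𝓡∂ 2) φ p : Plane →L[ℝ] Plane).det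
  /-- the arcs, parametrized by `[0,1]` -/
  a : Fin N → ℝ → S
  a_smooth : ∀ i, ContMDiffOn 𝓘(ℝ, ℝ) (𝓡∂ 2) ∞ (a i) (Icc 0 1)
  a_injOn : ∀ i, InjOn (a i) (Icc 0 1)
  a_immersed : ∀ i, ∀ t ∈ Icc (0 : ℝ) 1,
    mfderivWithin 𝓘(ℝ, ℝ) (𝓡∂ 2) (a i) (Icc 0 1) t ≠ 0
  a_proper : ∀ i, ∀ t ∈ Icc (0 : ℝ) 1, a i t ∈ bd S ↔ t = 0 ∨ t = 1
  a_disjoint : Pairwise fun i j => Disjoint (a i '' Icc 0 1) (a j '' Icc 0 1)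
  /-- every component of the surface cut open along the arcs is a disk -/
  disks : ∀ p ∈ (⋃ i, a i '' Icc 0 1)ᶜ,
    Nonempty (↥(connectedComponentIn (⋃ i, a i '' Icc 0 1)ᶜ p \ bd S) ≃ₜ Plane)

/-- The strip `[0,1] × ℝ`. -/
def stripDomain : Set Plane := {v | v 0 ∈ Icc (0 : ℝ) 1}

/-- The union of the arcs `a_i`. -/
def OpenBookDiagram.arcs {N : ℕ} (B : OpenBookDiagram S N) : Set S :=
  ⋃ i, B.a i '' Icc 0 1

/-- The choices from which an open book diagram yields a multi-pointed Heegaard diagram: the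
isotopic copies `b_i` of the arcs `a_i`, and the basepoints.  The arc `b_i` is the graph of a
function `f_i` in a tubular neighbourhood `[0,1] × ℝ` of `a_i = [0,1] × {0}` (it is the graph
of the exact form `f_i dt`, so it is a Hamiltonian isotopic copy of `a_i`, with end points moving
in `∂S`), and it meets `a_i` in a single point, transversely and positively. -/
structure HeegaardChoice {N : ℕ} (B : OpenBookDiagram S N) where
  /-- oriented tubular neighbourhoods of the arcs -/
  strip : Fin N → Plane → S
  strip_smooth : ∀ i, ContMDiffOn 𝓘(ℝ, Plane) (𝓡∂ 2) ∞ (strip i) stripDomain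
  strip_embedding : ∀ i, IsOpenEmbedding (stripDomain.domRestrict (strip i))
  strip_orient : ∀ i, ∀ v ∈ stripDomain,
    0 < (mfderivWithin 𝓘(ℝ, Plane) (𝓡∂ 2) (strip i) stripDomain v : Plane →L[ℝ] Plane).det
  strip_proper : ∀ i, ∀ v ∈ stripDomain, strip i v ∈ bd S ↔ v 0 = 0 ∨ v 0 = 1
  strip_arc : ∀ i, ∀ t ∈ Icc (0 : ℝ) 1, strip i !₂[t, 0] = B.a i t
  strip_disjoint : Pairwise fun i j => Disjoint (strip i '' stripDomain) (strip j '' stripDomain)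
  /-- the function whose graph is `b_i` -/
  f : Fin N → ℝ → ℝ
  f_smooth : ∀ i, ContDiff ℝ ∞ (f i)
  /-- the time at which `a_i` and `b_i` meet -/
  τ : Fin N → ℝ
  τ_mem : ∀ i, τ i ∈ Ioo (0 : ℝ) 1
  f_zero : ∀ i, ∀ t ∈ Icc (0 : ℝ) 1, f i t = 0 ↔ t = τ i
  f_pos : ∀ i, 0 < deriv (f i) (τ i)
  /-- on the page `S_0` the arcs `a_i` and `φ(b_j)` meet transversely -/
  transverse : ∀ i j, ∀ s ∈ Icc (0 : ℝ) 1, ∀ t ∈ Icc (0 : ℝ) 1,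
    B.a i s = B.φ (strip j !₂[t, f j t]) →
    det2 (velocity (fun r => B.φ (strip j !₂[r, f j r])) t) (velocity (B.a i) s) ≠ 0
  /-- the basepoints, in `S_{1/2}` -/
  Z : Set S
  Z_interior : Disjoint Z (bd S)
  /-- the basepoints lie outside the closed thin strips between `a_i` and `b_i` -/
  Z_strip : ∀ i, ∀ t ∈ Icc (0 : ℝ) 1, ∀ s ∈ uIcc 0 (f i t), strip i !₂[t, s] ∉ Z
  /-- every component of the complement of the arcs contains exactly one basepoint -/
  Z_component : ∀ p ∈ B.arcsᶜ, ∃! q, q ∈ Z ∧ q ∈ connectedComponentIn B.arcsᶜ p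

namespace HeegaardChoice

variable {N : ℕ} {B : OpenBookDiagram S N} (H : HeegaardChoice B)

/-- The arc `b_j`. -/
def b (j : Fin N) (t : ℝ) : S := H.strip j !₂[t, H.f j t]

/-- The part of the curve `β_j` on a page: `b_j` on `S_{1/2}` and `φ(b_j)` on `S_0`. -/
def bOn : Page → Fin N → ℝ → S
  | .half, j, t => H.b j t
  | .zero, j, t => B.φ (H.b j t)

/-- The closed curve `α_i = a_i ∪ -a_i` in the Heegaard surface. -/
def alpha (_H : HeegaardChoice B) (i : Fin N) : Set (Double S) :=
  ⋃ P : Page, (fun t => P.incl (B.a i t)) '' Icc 0 1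

/-- The closed curve `β_j = b_j ∪ -φ(b_j)` in the Heegaard surface. -/
def beta (j : Fin N) : Set (Double S) :=
  ⋃ P : Page, (fun t => P.incl (H.bOn P j t)) '' Icc 0 1

/-- The union of all the `α`- and `β`-curves. -/
def curves : Set (Double S) := (⋃ i, H.alpha i) ∪ ⋃ j, H.beta j

/-- The contact intersection point of `α_i` and `β_i`. -/
def contact (i : Fin N) : Double S := Page.half.incl (B.a i (H.τ i))

/-- The regions, represented by their interiors: the connected components of the complement of
the curves. -/
abbrev Region : Type _ := ConnectedComponents ↥(H.curvesᶜ)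

/-- A region is pointed if it contains a basepoint. -/
def Pointed (R : H.Region) : Prop :=
  ∃ q : ↥(H.curvesᶜ), ConnectedComponents.mk q = R ∧ ∃ z ∈ H.Z, q.1 = Page.half.incl z

/-- The formal integer linear combinations of unpointed regions. -/
abbrev Chain : Type _ := {R : H.Region // ¬ H.Pointed R} →₀ ℤ

variable {H}

open Classical in
/-- The multiplicity of a 2-chain at a point off the curves (zero in the pointed regions). -/
def mult (D : H.Chain) (q : Double S) : ℤ :=
  if h : q ∈ H.curvesᶜ then
    if hR : H.Pointed (ConnectedComponents.mk ⟨q, h⟩) then 0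
    else D ⟨ConnectedComponents.mk ⟨q, h⟩, hR⟩
  else 0

/-- The 2-chain `D` has multiplicity `n` in the region which one enters when leaving the point
`p` of the page `P` in the direction `w`. -/
def HasMultAlong (D : H.Chain) (P : Page) (p : S) (w : Plane) (n : ℤ) : Prop :=
  ∀ᶠ ε : ℝ in 𝓝[>] 0,
    mult D (P.incl ((extChartAt (𝓡∂ 2) p).symm (extChartAt (𝓡∂ 2) p p + ε • w))) = n

/-- At a point `p` where two curves cross, let `v` be the direction of one of the four edges that
leave `p`, and let `u` be tangent to the other curve.  Then `c` is the coefficient in `∂D` of that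
edge, oriented away from `p`: the multiplicity of `D` on its left minus that on its right.  The
sectors on the two sides of the edge contain the directions `v + u` and `v - u`. -/
def HasEdgeCoeff (D : H.Chain) (P : Page) (p : S) (v u : Plane) (c : ℤ) : Prop :=
  ∃ m n : ℤ, HasMultAlong D P p (v + u) m ∧ HasMultAlong D P p (v - u) n ∧
    c = P.sign * (SignType.sign (det2 v u) : ℤ) * (m - n)

/-- At a point `p` where a `β`-curve with velocity `v` crosses an `α`-curve with velocity `u`,
the 0-chain `∂(∂|_β D)` has coefficient `c`.  The two edges of the `β`-curve at `p` point in the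
directions `v` and `-v`; each of them, oriented away from `p`, has boundary `-p` at `p`. -/
def HasBoundaryCoeff (D : H.Chain) (P : Page) (p : S) (v u : Plane) (c : ℤ) : Prop :=
  ∃ c₁ c₂ : ℤ, HasEdgeCoeff D P p v u c₁ ∧ HasEdgeCoeff D P p (-v) u c₂ ∧ c = -c₁ - c₂

variable (H)

/-- A set of intersection points which determines a one-to-one pairing between the `α`-curves and
the `β`-curves. -/
structure IsGenerator (x : Set (Double S)) : Prop where
  subset : x ⊆ (⋃ i, H.alpha i) ∩ ⋃ j, H.beta j
  alpha_unique : ∀ i, ∃! p, p ∈ x ∧ p ∈ H.alpha i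
  beta_unique : ∀ j, ∃! p, p ∈ x ∧ p ∈ H.beta j

/-- The domains from `x` to `y`: the 2-chains `D` of unpointed regions with
`∂(∂|_β D) = y - x`. -/
def piHat (x y : Set (Double S)) : Set H.Chain :=
  {D | ∀ (P : Page) (i j : Fin N), ∀ s ∈ Icc (0 : ℝ) 1, ∀ t ∈ Icc (0 : ℝ) 1,
    B.a i s = H.bOn P j t →
    HasBoundaryCoeff D P (B.a i s) (velocity (H.bOn P j) t) (velocity (B.a i) s)
      (y.indicator 1 (P.incl (B.a i s)) - x.indicator 1 (P.incl (B.a i s)))}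

end HeegaardChoice

end Diagram

end OpenBook

end

open Set Filter Topology Manifold
open scoped ContDiff

noncomputable section

/-! On the page $S_{1/2}$ the curves cut out only two kinds of regions. Pushing a component of the
complement of the arcs $a_i$ off the thin strips shows that its part outside the strips lies in one
region, which contains the basepoint of that component. A domain therefore has multiplicity 0 there
(`mult_of_outer`). What remains are the two halves of each thin strip, after and before the contact
point. At the contact point these halves are two opposite sectors, and the condition on
$\partial(\partial|_\beta D)$ says that their multiplicities add up to $[x_\xi^i\in\mathbf
y]-[x_\xi^i\in\mathbf x]$ (`contact_equation`). For a positive domain the pair is $(1,0)$ or $(0,1)$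
if $x_\xi^i\in\mathbf y\setminus\mathbf x$, and $(0,0)$ otherwise; the sum $-1$ cannot occur. So
there are at most $2^k$ possibilities on $S_{1/2}$.

A domain is determined by its multiplicities on $S_{1/2}$ (`eq_of_mem_piHat`). Let $E$ be the
difference of two domains that agree there, viewed on $S_0$. It vanishes on $\partial S$, and at
each crossing of $a_i$ with $\varphi(b_j)$ the alternating sum of its four values is 0, because both
domains have the same boundary. Hence the jump of $E$ across an arc does not change when the arc
passes through a crossing. Each arc starts on $\partial S$, where the jump is 0, so $E$ has no jumps
at all (`IsArcSystem.goodAt`). The set where $E$ vanishes is then clopen and contains $\partial S$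
and all arcs $a_i$. A component of $S$ that avoids it would be compact and, by the disk condition,
homeomorphic to the plane, which is absurd (`IsArcSystem.eq_zero_of_disks`). -/

namespace OpenBook

/-! ### Integer functions that are constant off a union of arcs: behaviour near tubes and crossings.
-/

section Topology

variable {S : Type*} [TopologicalSpace S]

/-- The band `[0,1] × ℝ`. -/
def band : Set (ℝ × ℝ) := Icc 0 1 ×ˢ univ

theorem mem_band {v : ℝ × ℝ} : v ∈ band ↔ v.1 ∈ Icc (0 : ℝ) 1 := by simp [band]

theorem convex_band : Convex ℝ band := (convex_Icc 0 1).prod convex_univ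

/-- A topological tubular neighbourhood, parametrized by the band. -/
structure IsTube (T : ℝ × ℝ → S) : Prop where
  injOn : InjOn T band
  -- The relative filter covers the ends of the arc too: there half-disks in the band are mapped
  -- onto full neighbourhoods in the surface with boundary.
  map_nhds : ∀ v ∈ band, map T (𝓝[band] v) = 𝓝 (T v)

/-- The core arc of a tube. -/
def core (T : ℝ × ℝ → S) : Set S := (fun t => T (t, 0)) '' Icc 0 1

theorem IsTube.continuousOn {T : ℝ × ℝ → S} (hT : IsTube T) : ContinuousOn T band :=
  fun v hv => (hT.map_nhds v hv).le

theorem tendsto_vertical {s x : ℝ} (hs : s ∈ Icc (0 : ℝ) 1) (l : Filter ℝ) (hl : l ≤ 𝓝 x) :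
    Tendsto (fun ε : ℝ => (s, ε)) l (𝓝[band] (s, x)) := by
  refine tendsto_nhdsWithin_iff.2 ⟨?_, Eventually.of_forall fun ε => mem_band.2 hs⟩
  exact (Continuous.tendsto (by fun_prop) x).mono_left hl

theorem tendsto_horizontal {s : ℝ} :
    Tendsto (fun s' : ℝ => (s', (0 : ℝ))) (𝓝[Icc 0 1] s) (𝓝[band] (s, 0)) := by
  refine tendsto_nhdsWithin_iff.2 ⟨?_, ?_⟩
  · exact (Continuous.tendsto (by fun_prop) s).mono_left nhdsWithin_le_nhds
  · filter_upwards [self_mem_nhdsWithin] with s' hs' using mem_band.2 hs'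

theorem IsTube.continuousOn_core {T : ℝ × ℝ → S} (hT : IsTube T) :
    ContinuousOn (fun t => T (t, 0)) (Icc 0 1) :=
  hT.continuousOn.comp (by fun_prop) fun _ ht => mem_band.2 ht

theorem IsTube.isCompact_core {T : ℝ × ℝ → S} (hT : IsTube T) : IsCompact (core T) :=
  isCompact_Icc.image_of_continuousOn hT.continuousOn_core

theorem IsTube.mem_core_iff {T : ℝ × ℝ → S} (hT : IsTube T) {v : ℝ × ℝ} (hv : v ∈ band) :
    T v ∈ core T ↔ v.2 = 0 := by
  constructor
  · rintro ⟨t, ht, h⟩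
    rw [← hT.injOn (mem_band.2 ht) hv h]
  · intro h
    exact ⟨v.1, mem_band.1 hv, by rw [← h]⟩

/-- `E` takes a single value on every connected set that avoids `Γ`. -/
def ConstOff (Γ : Set S) (E : S → ℤ) : Prop :=
  ∀ X : Set S, IsPreconnected X → X ⊆ Γᶜ → ∀ p ∈ X, ∀ q ∈ X, E p = E q

/-- Near `p`, the function `E` takes a single value off `Γ`. -/
def GoodAt (Γ : Set S) (E : S → ℤ) (p : S) : Prop :=
  ∃ n : ℤ, ∀ᶠ q in 𝓝 p, q ∉ Γ → E q = n

variable {Γ : Set S} {E : S → ℤ} {T : ℝ × ℝ → S}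

/-- A small ball in the band minus the core line consists of two convex halves. Their images are
connected and miss `Γ`, so `E` is constant on each. -/
theorem IsTube.exists_sides (hT : IsTube T) (hE : ConstOff Γ E) {s : ℝ} (hs : s ∈ Icc (0 : ℝ) 1)
    (hΓ : ∀ᶠ q in 𝓝 (T (s, 0)), q ∈ Γ → q ∈ core T) :
    ∃ n m : ℤ, ∀ᶠ v in 𝓝[band] (s, 0),
      (0 < v.2 → E (T v) = n) ∧ (v.2 < 0 → E (T v) = m) ∧ (T v ∈ Γ → v.2 = 0) := by
  have h0 : (s, (0 : ℝ)) ∈ band := mem_band.2 hs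
  rw [← hT.map_nhds _ h0, eventually_map, eventually_nhdsWithin_iff,
    Metric.eventually_nhds_iff_ball] at hΓ
  obtain ⟨δ, hδ, h⟩ := hΓ
  have key : ∀ I : Set ℝ, Convex ℝ I → (0 : ℝ) ∉ I →
      ∀ v ∈ Metric.ball (s, (0 : ℝ)) δ ∩ band ∩ Prod.snd ⁻¹' I,
      ∀ w ∈ Metric.ball (s, (0 : ℝ)) δ ∩ band ∩ Prod.snd ⁻¹' I, E (T v) = E (T w) := by
    intro I hI hI0 v hv w hw
    have hc : Convex ℝ (Metric.ball (s, (0 : ℝ)) δ ∩ band ∩ Prod.snd ⁻¹' I) :=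
      ((convex_ball _ _).inter convex_band).inter (hI.linear_preimage (LinearMap.snd ℝ ℝ ℝ))
    refine hE (T '' (Metric.ball (s, (0 : ℝ)) δ ∩ band ∩ Prod.snd ⁻¹' I))
      (hc.isPreconnected.image T (hT.continuousOn.mono fun x hx => hx.1.2)) ?_ _
      (mem_image_of_mem T hv) _ (mem_image_of_mem T hw)
    rintro _ ⟨x, hx, rfl⟩ hxΓ
    have := (hT.mem_core_iff hx.1.2).1 (h x hx.1.1 hx.1.2 hxΓ)
    exact hI0 (this ▸ hx.2)
  -- Sample points are displaced vertically, so they stay in the band when `s` is an end point.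
  refine ⟨E (T (s, δ / 2)), E (T (s, -(δ / 2))), ?_⟩
  have hb : Metric.ball (s, (0 : ℝ)) δ ∩ band ∈ 𝓝[band] (s, (0 : ℝ)) :=
    inter_mem (mem_nhdsWithin_of_mem_nhds (Metric.ball_mem_nhds _ hδ)) self_mem_nhdsWithin
  filter_upwards [hb] with v hv
  refine ⟨fun hv' => ?_, fun hv' => ?_, fun hvΓ => ?_⟩
  · refine key (Ioi 0) (convex_Ioi 0) (by simp) v ⟨hv, hv'⟩ _ ⟨⟨?_, mem_band.2 hs⟩, ?_⟩
    · simp [Prod.dist_eq, abs_of_pos hδ, hδ]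
    · simp [hδ]
  · refine key (Iio 0) (convex_Iio 0) (by simp) v ⟨hv, hv'⟩ _ ⟨⟨?_, mem_band.2 hs⟩, ?_⟩
    · simp [Prod.dist_eq, abs_of_pos hδ, hδ]
    · simp [hδ]
  · exact (hT.mem_core_iff hv.2).1 (h v hv.1 hv.2 hvΓ)

theorem eventually_vertical {s : ℝ} (hs : s ∈ Icc (0 : ℝ) 1) {Q : ℝ × ℝ → Prop}
    (h : ∀ᶠ v in 𝓝[band] (s, 0), Q v) : ∃ x : ℝ, 0 < x ∧ Q (s, x) ∧ Q (s, -x) := by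
  have h1 : ∀ᶠ x : ℝ in 𝓝[>] 0, Q (s, x) :=
    (tendsto_vertical hs (𝓝[>] (0 : ℝ)) nhdsWithin_le_nhds).eventually h
  have hneg : Tendsto (fun x : ℝ => (s, -x)) (𝓝[>] 0) (𝓝[band] (s, 0)) := by
    refine tendsto_nhdsWithin_iff.2 ⟨?_, Eventually.of_forall fun ε => mem_band.2 hs⟩
    exact ((Continuous.tendsto' (by fun_prop) (0 : ℝ) (s, (0 : ℝ)) (by simp))).mono_left
      nhdsWithin_le_nhds
  obtain ⟨x, hx, hx1, hx2⟩ := ((eventually_mem_nhdsWithin (a := (0 : ℝ))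
    (s := Ioi 0)).and (h1.and (hneg.eventually h))).exists
  exact ⟨x, hx, hx1, hx2⟩

theorem IsTube.goodAt_iff_of_sides (hT : IsTube T) {s : ℝ} (hs : s ∈ Icc (0 : ℝ) 1) {n m : ℤ}
    (h : ∀ᶠ v in 𝓝[band] (s, 0),
      (0 < v.2 → E (T v) = n) ∧ (v.2 < 0 → E (T v) = m) ∧ (T v ∈ Γ → v.2 = 0))
    (hcore : core T ⊆ Γ) : GoodAt Γ E (T (s, 0)) ↔ n = m := by
  constructor
  · rintro ⟨k, hk⟩
    rw [← hT.map_nhds _ (mem_band.2 hs), eventually_map] at hk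
    obtain ⟨x, hx, ⟨⟨h1, -, h3⟩, h4⟩, ⟨-, h6, h7⟩, h8⟩ := eventually_vertical hs (h.and hk)
    rw [← h1 hx, ← h6 (by simpa using hx), h4 fun hc => hx.ne' (h3 hc),
      h8 fun hc => hx.ne' (by simpa using h7 hc)]
  · rintro rfl
    refine ⟨n, ?_⟩
    rw [← hT.map_nhds _ (mem_band.2 hs), eventually_map]
    filter_upwards [h, self_mem_nhdsWithin] with v ⟨h1, h2, _⟩ hv hvΓ
    rcases lt_trichotomy v.2 0 with h0 | h0 | h0
    · exact h2 h0
    · exact absurd (hcore ((hT.mem_core_iff hv).2 h0)) hvΓ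
    · exact h1 h0

/-- The same two side values serve for all nearby points of the core, so the absence of a jump is a
locally constant property away from crossings. -/
theorem IsTube.exists_goodAt_iff (hT : IsTube T) (hE : ConstOff Γ E) {s : ℝ}
    (hs : s ∈ Icc (0 : ℝ) 1) (hΓ : ∀ᶠ q in 𝓝 (T (s, 0)), q ∈ Γ → q ∈ core T)
    (hcore : core T ⊆ Γ) :
    ∃ P : Prop, ∀ᶠ s' in 𝓝[Icc 0 1] s, (GoodAt Γ E (T (s', 0)) ↔ P) := by
  obtain ⟨n, m, h⟩ := hT.exists_sides hE hs hΓ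
  refine ⟨n = m, ?_⟩
  have := tendsto_horizontal.eventually (eventually_eventually_nhdsWithin.2 h)
  filter_upwards [this, self_mem_nhdsWithin] with s' hs' hs'1
  exact hT.goodAt_iff_of_sides hs'1 hs' hcore

theorem IsTube.mem_closure_compl (hT : IsTube T) (hE : ConstOff Γ E) {s : ℝ}
    (hs : s ∈ Icc (0 : ℝ) 1) (hΓ : ∀ᶠ q in 𝓝 (T (s, 0)), q ∈ Γ → q ∈ core T) :
    T (s, 0) ∈ closure Γᶜ := by
  obtain ⟨n, m, h⟩ := hT.exists_sides hE hs hΓ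
  rw [mem_closure_iff_frequently, ← hT.map_nhds _ (mem_band.2 hs)]
  intro hc
  rw [eventually_map] at hc
  obtain ⟨x, hx, ⟨⟨-, -, h3⟩, h4⟩, -⟩ := eventually_vertical hs (h.and hc)
  exact h4 fun hx' => hx.ne' (h3 hx')

/-- One vertical fibre meets both sides of the core, so it determines both side values. This is
applied at the ends of an arc, where the fibre lies in the boundary. -/
theorem IsTube.eventually_eq_zero (hT : IsTube T) (hE : ConstOff Γ E) {s : ℝ}
    (hs : s ∈ Icc (0 : ℝ) 1) (hΓ : ∀ᶠ q in 𝓝 (T (s, 0)), q ∈ Γ → q ∈ core T)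
    (hcore : core T ⊆ Γ) (h0 : ∀ x, T (s, x) ∉ Γ → E (T (s, x)) = 0) :
    ∀ᶠ q in 𝓝 (T (s, 0)), q ∉ Γ → E q = 0 := by
  obtain ⟨n, m, h⟩ := hT.exists_sides hE hs hΓ
  obtain ⟨x, hx, ⟨h1, -, h3⟩, ⟨-, h6, h7⟩⟩ := eventually_vertical hs h
  have hn : n = 0 := by rw [← h1 hx, h0 x fun hc => hx.ne' (h3 hc)]
  have hm : m = 0 := by
    rw [← h6 (by simpa using hx), h0 _ fun hc => hx.ne' (by simpa using h7 hc)]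
  subst hn hm
  rw [← hT.map_nhds _ (mem_band.2 hs), eventually_map]
  filter_upwards [h, self_mem_nhdsWithin] with v ⟨h1, h2, _⟩ hv hvΓ
  rcases lt_trichotomy v.2 0 with h0 | h0 | h0
  · exact h2 h0
  · exact absurd (hcore ((hT.mem_core_iff hv).2 h0)) hvΓ
  · exact h1 h0

/-- Near the crossing `p`, the local coordinates `e` take `Γ` to the two axes, and `E` takes the
values `n` on the four quadrants, with vanishing alternating sum. -/
structure IsCrossing (Γ : Set S) (E : S → ℤ) (e : OpenPartialHomeomorph S (ℝ × ℝ)) (p : S)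
    (n : SignType → SignType → ℤ) : Prop where
  mem : p ∈ e.source
  zero : e p = 0
  mem_iff : ∀ᶠ q in 𝓝 p, (q ∈ Γ ↔ (e q).1 = 0 ∨ (e q).2 = 0)
  val : ∀ᶠ q in 𝓝 p, (e q).1 ≠ 0 → (e q).2 ≠ 0 →
    E q = n (SignType.sign (e q).1) (SignType.sign (e q).2)
  balance : n 1 1 + n (-1) (-1) = n 1 (-1) + n (-1) 1

theorem IsCrossing.swap {e : OpenPartialHomeomorph S (ℝ × ℝ)} {p : S}
    {n : SignType → SignType → ℤ} (h : IsCrossing Γ E e p n) :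
    IsCrossing Γ E (e.trans (Homeomorph.prodComm ℝ ℝ).toOpenPartialHomeomorph) p
      (fun σ τ => n τ σ) where
  mem := by simpa using h.mem
  zero := by simp [h.zero]
  mem_iff := by
    filter_upwards [h.mem_iff] with q hq
    simpa [or_comm] using hq
  val := by
    filter_upwards [h.val] with q hq h1 h2
    simpa using hq h2 h1
  balance := by rw [h.balance, add_comm]

theorem convex_sign_preimage (σ : SignType) : Convex ℝ {x : ℝ | SignType.sign x = σ} := by
  cases σ
  · simp [convex_singleton]
  · simpa [sign_eq_neg_one_iff, Iio] using convex_Iio (𝕜 := ℝ) (0 : ℝ)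
  · simpa [sign_eq_one_iff, Ioi] using convex_Ioi (𝕜 := ℝ) (0 : ℝ)

/-- An open quadrant of a small ball is convex, so its preimage is connected and avoids `Γ`. -/
theorem exists_quadrant_values (hE : ConstOff Γ E) {e : OpenPartialHomeomorph S (ℝ × ℝ)} {p : S}
    (hp : p ∈ e.source) (h0 : e p = 0)
    (hΓ : ∀ᶠ q in 𝓝 p, (q ∈ Γ ↔ (e q).1 = 0 ∨ (e q).2 = 0)) :
    ∃ n : SignType → SignType → ℤ, ∀ᶠ q in 𝓝 p, (e q).1 ≠ 0 → (e q).2 ≠ 0 →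
      E q = n (SignType.sign (e q).1) (SignType.sign (e q).2) := by
  have hp' : (0 : ℝ × ℝ) ∈ e.target := h0 ▸ e.map_source hp
  have hs0 : e.symm 0 = p := by rw [← h0, e.left_inv hp]
  have hev : ∀ᶠ z in 𝓝 (0 : ℝ × ℝ), z ∈ e.target ∧
      (e.symm z ∈ Γ ↔ (e (e.symm z)).1 = 0 ∨ (e (e.symm z)).2 = 0) := by
    refine Eventually.and (e.open_target.mem_nhds hp') ?_
    have := e.symm.continuousAt hp'
    rw [ContinuousAt, hs0] at this
    exact this.eventually hΓ
  obtain ⟨δ, hδ, h⟩ := Metric.eventually_nhds_iff_ball.1 hev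
  -- One sample coordinate for each sign; the value at sign 0 is never tested.
  let c : SignType → ℝ := fun σ => σ * (δ / 2)
  have hc : ∀ σ, SignType.sign (c σ) = σ := fun σ => by
    have h2 : (0 : ℝ) < δ / 2 := by positivity
    rcases σ with _ | _ | _ <;> simp [c, hδ]
  have hcδ : ∀ σ, |c σ| < δ := fun σ => by
    have h2 : |δ / 2| < δ := by rw [abs_of_pos (by positivity)]; linarith
    rcases σ with _ | _ | _ <;> simp [c, hδ, h2]
  refine ⟨fun σ τ => E (e.symm (c σ, c τ)), ?_⟩
  have hcont := e.continuousAt hp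
  rw [ContinuousAt, h0] at hcont
  filter_upwards [e.open_source.mem_nhds hp, hcont.eventually (Metric.ball_mem_nhds _ hδ)]
    with q hq hqb h1 h2
  set Q : Set (ℝ × ℝ) := Metric.ball 0 δ ∩ ({x : ℝ | SignType.sign x = SignType.sign (e q).1} ×ˢ
    {x : ℝ | SignType.sign x = SignType.sign (e q).2}) with hQ
  have hconv : Convex ℝ Q := (convex_ball _ _).inter
    ((convex_sign_preimage _).prod (convex_sign_preimage _))
  have himg : IsPreconnected (e.symm '' Q) :=
    hconv.isPreconnected.image _ (e.symm.continuousOn.mono fun z hz => (h z hz.1).1)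
  refine hE _ himg ?_ q ⟨e q, ⟨hqb, by simp⟩, e.left_inv hq⟩ _ ⟨_, ⟨?_, ?_⟩, rfl⟩
  · rintro _ ⟨z, hz, rfl⟩ hzΓ
    obtain ⟨hzt, hziff⟩ := h z hz.1
    rw [hziff, e.right_inv hzt] at hzΓ
    obtain ⟨-, hz1, hz2⟩ := hz
    simp only [mem_ofPred_eq] at hz1 hz2
    rcases hzΓ with h' | h'
    · rw [h', sign_zero, eq_comm, sign_eq_zero_iff] at hz1
      exact h1 hz1
    · rw [h', sign_zero, eq_comm, sign_eq_zero_iff] at hz2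
      exact h2 hz2
  · simp [hcδ, dist_eq_norm]
  · simp [hc]

/-- The curve runs along the axis where the first coordinate vanishes. By `balance` the jump across
this axis is the same on both sides of the crossing, so one condition on `n` governs both. -/
theorem IsCrossing.eventually_goodAt_iff {e : OpenPartialHomeomorph S (ℝ × ℝ)} {p : S}
    {n : SignType → SignType → ℤ} (h : IsCrossing Γ E e p n) {c : ℝ → S} {s : ℝ}
    (hs : s ∈ Icc (0 : ℝ) 1) (hcs : c s = p) (hc : ContinuousOn c (Icc 0 1))
    (hinj : InjOn c (Icc 0 1)) (hline : ∀ᶠ s' in 𝓝[Icc 0 1] s, (e (c s')).1 = 0) :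
    ∀ᶠ s' in 𝓝[Icc 0 1 \ {s}] s, (GoodAt Γ E (c s') ↔ n 1 1 = n (-1) 1) := by
  have hle : 𝓝[Icc 0 1 \ {s}] s ≤ 𝓝[Icc 0 1] s := nhdsWithin_mono _ sdiff_subset
  have hcc : Tendsto c (𝓝[Icc 0 1] s) (𝓝 p) := hcs ▸ hc s hs
  have hall := (e.open_source.eventually_mem h.mem).and (h.mem_iff.and h.val)
  have hall' := hle (hcc.eventually (eventually_eventually_nhds.2 hall))
  filter_upwards [hall', hle hline, self_mem_nhdsWithin] with s' hs' hline' hmem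
  set q' := c s' with hq'
  have hq's : q' ∈ e.source := hs'.self_of_nhds.1
  have hne : (e q').2 ≠ 0 := by
    intro h2
    have : e q' = e p := by rw [h.zero]; exact Prod.ext hline' h2
    exact hmem.2 (hinj hmem.1 hs (by rw [← hq', hcs]; exact e.injOn hq's h.mem this))
  set σ := SignType.sign (e q').2 with hσ
  -- The difference `n 1 σ - n (-1) σ` does not depend on `σ = ±1`.
  have hbal : (n 1 1 = n (-1) 1) ↔ n 1 σ = n (-1) σ := by
    have hb := h.balance
    have hσ0 : σ ≠ 0 := by rw [hσ]; simpa [sign_eq_zero_iff] using hne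
    rcases hσ' : σ with _ | _ | _
    · exact absurd hσ' hσ0
    · show _ ↔ n 1 (-1) = n (-1) (-1)
      constructor <;> intro <;> linarith
    · exact Iff.rfl
  rw [hbal]
  have hq't := e.map_source hq's
  constructor
  · rintro ⟨m, hm⟩
    -- The point is approached from both sides, transversally to the curve, by varying the first
    -- coordinate.
    have hlim : Tendsto (fun ε : ℝ => e.symm (ε, (e q').2)) (𝓝 0) (𝓝 q') := by
      have h1 := e.symm.continuousAt hq't
      rw [ContinuousAt, OpenPartialHomeomorph.left_inv _ hq's] at h1
      refine h1.comp (Continuous.tendsto' (by fun_prop) _ _ ?_)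
      exact Prod.ext hline'.symm rfl
    have htgt : ∀ᶠ ε : ℝ in 𝓝 0, (ε, (e q').2) ∈ e.target := by
      refine (Continuous.tendsto' (by fun_prop) (0 : ℝ) (e q') ?_).eventually
        (e.open_target.mem_nhds hq't)
      exact Prod.ext hline'.symm rfl
    have hev : ∀ᶠ ε : ℝ in 𝓝 0, ε ≠ 0 → n (SignType.sign ε) σ = m := by
      filter_upwards [htgt, hlim.eventually hs', hlim.eventually hm] with ε h1 h2 h3 hε
      obtain ⟨-, h4, h5⟩ := h2
      rw [e.right_inv h1] at h4 h5
      rw [← h3 (by rw [h4]; simp [hε, hne]), h5 hε hne]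
    obtain ⟨δ, hδ, hball⟩ := Metric.eventually_nhds_iff_ball.1 hev
    have e1 := hball (δ / 2) (by simp [abs_of_pos hδ, hδ]) (by positivity)
    have e2 := hball (-(δ / 2)) (by simp [abs_of_pos hδ, hδ])
      (by simpa using hδ.ne')
    rw [sign_pos (by positivity)] at e1
    rw [sign_neg (by simpa using hδ)] at e2
    rw [e1, e2]
  · intro hn
    refine ⟨n 1 σ, ?_⟩
    have hsgn : ∀ᶠ q in 𝓝 q', SignType.sign (e q).2 = σ := by
      have hcont : ContinuousAt (fun q => (e q).2) q' :=
        continuous_snd.continuousAt.comp (e.continuousAt hq's)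
      rcases lt_or_gt_of_ne hne with h' | h'
      · filter_upwards [hcont.eventually (gt_mem_nhds h')] with q hq
        rw [hσ, sign_neg h', sign_neg hq]
      · filter_upwards [hcont.eventually (lt_mem_nhds h')] with q hq
        rw [hσ, sign_pos h', sign_pos hq]
    filter_upwards [hs', hsgn] with q ⟨_, h4, h5⟩ h6 hqΓ
    rw [h4, not_or] at hqΓ
    rw [h5 hqΓ.1 hqΓ.2, h6]
    rcases lt_or_gt_of_ne hqΓ.1 with h' | h'
    · rw [sign_neg h', hn]
    · rw [sign_pos h']

theorem IsCrossing.mem_closure_compl {e : OpenPartialHomeomorph S (ℝ × ℝ)} {p : S}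
    {n : SignType → SignType → ℤ} (h : IsCrossing Γ E e p n) : p ∈ closure Γᶜ := by
  have hp' : (0 : ℝ × ℝ) ∈ e.target := h.zero ▸ e.map_source h.mem
  have hs0 : e.symm 0 = p := by rw [← h.zero, e.left_inv h.mem]
  have h1 := e.symm.continuousAt hp'
  rw [ContinuousAt, hs0] at h1
  have hdiag : Tendsto (fun ε : ℝ => (ε, ε)) (𝓝[>] 0) (𝓝 (0 : ℝ × ℝ)) :=
    (Continuous.tendsto' (by fun_prop) _ _ rfl).mono_left nhdsWithin_le_nhds
  refine mem_closure_of_tendsto (h1.comp hdiag) ?_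
  filter_upwards [(h1.comp hdiag).eventually h.mem_iff, hdiag.eventually
    (e.open_target.mem_nhds hp'), self_mem_nhdsWithin] with ε h2 h3 h4
  simp only [Function.comp_apply, mem_compl_iff] at h2 ⊢
  rw [h2, e.right_inv h3]
  simpa using (ne_of_gt h4)

theorem neBot_nhdsWithin_Icc_diff {s : ℝ} (hs : s ∈ Icc (0 : ℝ) 1) :
    (𝓝[Icc (0 : ℝ) 1 \ {s}] s).NeBot := by
  rw [← mem_closure_iff_nhdsWithin_neBot]
  have : AccPt s (𝓟 (Icc (0 : ℝ) 1)) :=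
    (isPreconnected_Icc.preperfect_of_nontrivial ⟨0, by simp, 1, by simp, by simp⟩) s hs
  rwa [accPt_principal_iff_clusterPt, ← mem_closure_iff_clusterPt] at this

theorem IsCrossing.goodAt {e : OpenPartialHomeomorph S (ℝ × ℝ)} {p : S}
    {n : SignType → SignType → ℤ} (h : IsCrossing Γ E e p n) (h1 : n 1 1 = n (-1) 1)
    (h2 : n 1 1 = n 1 (-1)) : GoodAt Γ E p := by
  refine ⟨n 1 1, ?_⟩
  have hb := h.balance
  filter_upwards [h.mem_iff, h.val] with q h3 h4 hq
  rw [h3, not_or] at hq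
  rw [h4 hq.1 hq.2]
  rcases lt_or_gt_of_ne hq.1 with h5 | h5 <;> rcases lt_or_gt_of_ne hq.2 with h6 | h6 <;>
    simp only [sign_neg, sign_pos, h5, h6] <;> linarith

/-- A property of the points of `[0,1]` that is constant near each point, the point itself
excepted, and holds near `0`, holds near all the points. -/
theorem eventually_of_locally_iff {G : ℝ → Prop}
    (h : ∀ s ∈ Icc (0 : ℝ) 1, ∃ P : Prop, ∀ᶠ s' in 𝓝[Icc 0 1 \ {s}] s, (G s' ↔ P))
    (h0 : ∀ᶠ s' in 𝓝[Icc (0 : ℝ) 1 \ {0}] 0, G s') {s : ℝ} (hs : s ∈ Icc (0 : ℝ) 1) :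
    ∀ᶠ s' in 𝓝[Icc (0 : ℝ) 1 \ {s}] s, G s' := by
  have hstep : ∀ s ∈ Icc (0 : ℝ) 1, ∀ P : Prop, (∀ᶠ s' in 𝓝[Icc 0 1 \ {s}] s, (G s' ↔ P)) →
      ∀ᶠ s' in 𝓝[Icc 0 1] s, s' ≠ s → ∀ᶠ r in 𝓝[Icc 0 1 \ {s'}] s', (G r ↔ P) := by
    intro s hs P hP
    have hP' : ∀ᶠ r in 𝓝[Icc (0 : ℝ) 1] s, r ≠ s → (G r ↔ P) := by
      rw [eventually_nhdsWithin_iff] at hP ⊢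
      filter_upwards [hP] with r hr h1 h2 using hr ⟨h1, h2⟩
    filter_upwards [eventually_eventually_nhdsWithin.2 hP'] with s' hs' hne
    have := nhdsWithin_mono s' (sdiff_subset (s := Icc (0 : ℝ) 1) (t := {s'})) hs'
    filter_upwards [this, mem_nhdsWithin_of_mem_nhds (isOpen_ne.mem_nhds hne)] with r h1 h2
      using h1 h2
  -- The truth value of the punctured statement is locally constant in the base point, so
  -- connectedness of `[0,1]` makes it constant.
  have hpre : ∀ s ∈ Icc (0 : ℝ) 1, ∀ t ∈ Icc (0 : ℝ) 1,
      (∀ᶠ s' in 𝓝[Icc (0 : ℝ) 1 \ {s}] s, G s') = (∀ᶠ s' in 𝓝[Icc (0 : ℝ) 1 \ {t}] t, G s') := by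
    intro s hs t ht
    refine isPreconnected_Icc.induction₂ (fun s t => (∀ᶠ s' in 𝓝[Icc (0 : ℝ) 1 \ {s}] s, G s') =
      (∀ᶠ s' in 𝓝[Icc (0 : ℝ) 1 \ {t}] t, G s')) ?_ (fun _ _ _ _ _ _ h1 h2 => h1.trans h2)
      (fun _ _ _ _ h1 => h1.symm) hs ht
    intro s hs
    obtain ⟨P, hP⟩ := h s hs
    -- Punctured neighbourhood filters in `[0,1]` are nontrivial, so a constant proposition holds
    -- eventually only if it is true.
    have hiff : ∀ r ∈ Icc (0 : ℝ) 1, (∀ᶠ s' in 𝓝[Icc 0 1 \ {r}] r, (G s' ↔ P)) →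
        ((∀ᶠ s' in 𝓝[Icc 0 1 \ {r}] r, G s') = P) := by
      intro r hr hrP
      have := neBot_nhdsWithin_Icc_diff hr
      rw [eventually_congr hrP, eventually_const]
    filter_upwards [hstep s hs P hP, self_mem_nhdsWithin] with r hr hr1
    rcases eq_or_ne r s with rfl | hne
    · rfl
    · rw [hiff s hs hP, hiff r hr1 (hr hne)]
  rw [hpre s hs 0 (by simp)]
  exact h0

end Topology

/-! ### Smooth tubes and local coordinates at a transverse crossing. -/

section Smooth

/-- The first basis vector of the plane. -/
def e₀ : Plane := !₂[1, 0]

theorem det2_map (M : Plane →L[ℝ] Plane) (x y : Plane) :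
    det2 (M x) (M y) = M.det * det2 x y := by
  have hdet : M.det = det2 (M !₂[1, 0]) (M !₂[0, 1]) := by
    rw [ContinuousLinearMap.det,
      ← LinearMap.det_toMatrix (EuclideanSpace.basisFun (Fin 2) ℝ).toBasis,
      Matrix.det_fin_two]
    have h0 : EuclideanSpace.single (0 : Fin 2) (1 : ℝ) = !₂[1, 0] := by
      ext i; fin_cases i <;> simp
    have h1 : EuclideanSpace.single (1 : Fin 2) (1 : ℝ) = !₂[0, 1] := by
      ext i; fin_cases i <;> simp
    simp only [LinearMap.toMatrix_apply, OrthonormalBasis.coe_toBasis, EuclideanSpace.basisFun_apply,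
      OrthonormalBasis.coe_toBasis_repr_apply, EuclideanSpace.basisFun_repr, h0, h1,
      ContinuousLinearMap.coe_coe, det2]
    ring
  have hx : ∀ z : Plane, z = z 0 • (!₂[1, 0] : Plane) + z 1 • (!₂[0, 1] : Plane) := fun z => by
    ext i; fin_cases i <;> simp
  have hM : ∀ z : Plane, M z = z 0 • M !₂[1, 0] + z 1 • M !₂[0, 1] := fun z => by
    conv_lhs => rw [hx z]
    simp
  rw [hdet, hM x, hM y]
  simp [det2]
  ring

theorem det2_add_right (x y z : Plane) : det2 x (y + z) = det2 x y + det2 x z := by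
  simp [det2]; ring

theorem det2_smul_right (c : ℝ) (x y : Plane) : det2 x (c • y) = c * det2 x y := by
  simp [det2]; ring

theorem det2_self (x : Plane) : det2 x x = 0 := by
  simp [det2]; ring

theorem det2_swap (x y : Plane) : det2 x y = -det2 y x := by
  simp [det2]; ring

/-- The linear form `x ↦ det2 u x`. -/
def det2L (u : Plane) : Plane →L[ℝ] ℝ :=
  u 0 • EuclideanSpace.proj (1 : Fin 2) - u 1 • EuclideanSpace.proj (0 : Fin 2)

@[simp] theorem det2L_apply (u x : Plane) : det2L u x = det2 u x := by
  simp [det2L, det2]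

/-- The difference quotients along the ray tend to the directional derivative, whose sign they
eventually share. -/
theorem eventually_sign_ray {V : Type*} [NormedAddCommGroup V] [NormedSpace ℝ V] {g : V → ℝ}
    {g' : V →L[ℝ] ℝ} {y x : V} (hg : HasFDerivAt g g' y) (h0 : g y = 0) (hx : g' x ≠ 0) :
    ∀ᶠ ε : ℝ in 𝓝[>] 0, SignType.sign (g (y + ε • x)) = SignType.sign (g' x) := by
  have h1 : HasDerivAt (fun ε : ℝ => y + ε • x) x 0 := by
    simpa using ((hasDerivAt_id (0 : ℝ)).smul_const x).const_add y
  have h2 : HasDerivAt (fun ε : ℝ => g (y + ε • x)) (g' x) 0 := by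
    have hg' : HasFDerivAt g g' (y + (0 : ℝ) • x) := by simpa using hg
    exact hg'.comp_hasDerivAt (0 : ℝ) h1
  have h3 := h2.tendsto_slope_zero_right
  simp only [zero_add, zero_smul, add_zero, h0, sub_zero, smul_eq_mul] at h3
  rcases lt_or_gt_of_ne hx with h | h
  · filter_upwards [h3.eventually (gt_mem_nhds h), self_mem_nhdsWithin] with ε h4 h5
    have h6 : g (y + ε • x) < 0 := by
      by_contra! h7
      exact absurd (mul_nonneg (inv_nonneg.2 (le_of_lt h5)) h7) (not_le.2 h4)
    rw [sign_neg h, sign_neg h6]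
  · filter_upwards [h3.eventually (lt_mem_nhds h), self_mem_nhdsWithin] with ε h4 h5
    have h6 : 0 < g (y + ε • x) := by
      by_contra! h7
      exact absurd (mul_nonpos_of_nonneg_of_nonpos (inv_nonneg.2 (le_of_lt h5)) h7) (not_le.2 h4)
    rw [sign_pos h, sign_pos h6]

variable {S : Type*} [TopologicalSpace S] [ChartedSpace (EuclideanHalfSpace 2) S]

/-- The derivative of a map from the plane, read in the preferred chart at the image point. -/
def planeDeriv (F : Plane → S) (v : Plane) : Plane →L[ℝ] Plane :=
  mfderiv 𝓘(ℝ, Plane) (𝓡∂ 2) F v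

/-- An oriented smooth tubular neighbourhood of a properly embedded arc. -/
structure IsSmoothTube (F : Plane → S) : Prop where
  tube : IsTube fun z : ℝ × ℝ => F !₂[z.1, z.2]
  contMDiffAt : ∀ v : Plane, v 0 ∈ Ioo (0 : ℝ) 1 → ContMDiffAt 𝓘(ℝ, Plane) (𝓡∂ 2) 1 F v
  det_pos : ∀ v : Plane, v 0 ∈ Ioo (0 : ℝ) 1 →
    0 < (planeDeriv F v).det
  mem_bd_iff : ∀ v ∈ stripDomain, F v ∈ bd S ↔ v 0 = 0 ∨ v 0 = 1

theorem eta_plane (v : Plane) : !₂[v 0, v 1] = v := by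
  ext i; fin_cases i <;> simp

theorem IsSmoothTube.injOn {F : Plane → S} (hF : IsSmoothTube F) {v w : Plane}
    (hv : v ∈ stripDomain) (hw : w ∈ stripDomain) (h : F v = F w) : v = w := by
  have := hF.tube.injOn (x₁ := (v 0, v 1)) (x₂ := (w 0, w 1)) (mem_band.2 hv) (mem_band.2 hw)
    (by simpa [eta_plane] using h)
  rw [Prod.mk.injEq] at this
  rw [← eta_plane v, ← eta_plane w, this.1, this.2]

/-- The core arc of a smooth tube. -/
def arcOf {X : Type*} (F : Plane → X) : Set X := core fun z : ℝ × ℝ => F !₂[z.1, z.2]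

theorem IsSmoothTube.mem_arcOf_iff {F : Plane → S} (hF : IsSmoothTube F) {v : Plane}
    (hv : v ∈ stripDomain) : F v ∈ arcOf F ↔ v 1 = 0 := by
  have := hF.tube.mem_core_iff (v := (v 0, v 1)) (mem_band.2 hv)
  simpa [eta_plane, arcOf] using this

theorem hasStrictFDerivAt_extChartAt_comp {F : Plane → S} {v : Plane}
    (hF : ContMDiffAt 𝓘(ℝ, Plane) (𝓡∂ 2) 1 F v) :
    HasStrictFDerivAt (fun z => extChartAt (𝓡∂ 2) (F v) (F z))
      (planeDeriv F v) v := by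
  have h1 : ContDiffAt ℝ 1 (fun z => extChartAt (𝓡∂ 2) (F v) (F z)) v :=
    contMDiffAt_iff_contDiffAt.1 (contMDiffAt_iff_target.1 hF).2
  have h2 := (hF.mdifferentiableAt one_ne_zero).hasMFDerivAt.2
  have h3 : HasFDerivAt (fun z => extChartAt (𝓡∂ 2) (F v) (F z)) (planeDeriv F v) v := by
    rw [← hasFDerivWithinAt_univ]
    simp only [writtenInExtChartAt, extChartAt_model_space_eq_id, modelWithCornersSelf_coe,
      range_id] at h2
    exact h2
  exact h1.hasStrictFDerivAt' h3 one_ne_zero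

/-- The inverse function theorem gives tube coordinates `ℓ` as functions of the chart, with
derivative the inverse of `planeDeriv F v`. The last clause is Cramer's rule with `d` the Jacobian.
As `d` is positive, the sign of the height in the tube is that of a determinant with the tangent of
the core. -/
theorem IsSmoothTube.exists_chart_inverse {F : Plane → S} (hF : IsSmoothTube F) {v : Plane} {p : S}
    (hv : v 0 ∈ Ioo (0 : ℝ) 1) (hp : F v = p) :
    ∃ (ℓ : Plane → Plane) (L : Plane →L[ℝ] Plane) (d : ℝ), 0 < d ∧
      HasStrictFDerivAt ℓ L (extChartAt (𝓡∂ 2) p p) ∧ ℓ (extChartAt (𝓡∂ 2) p p) = v ∧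
      (∀ᶠ y in 𝓝 (extChartAt (𝓡∂ 2) p p),
        F (ℓ y) = (extChartAt (𝓡∂ 2) p).symm y ∧ ℓ y ∈ stripDomain) ∧
      ∀ x, L x 1 = det2 (planeDeriv F v e₀) x / d := by
  subst hp
  set M : Plane →L[ℝ] Plane := planeDeriv F v with hM
  have hdet : 0 < M.det := hF.det_pos v hv
  set M' := M.toContinuousLinearEquivOfDetNeZero hdet.ne' with hM'
  have hstrict : HasStrictFDerivAt (fun z => extChartAt (𝓡∂ 2) (F v) (F z))
      (M' : Plane →L[ℝ] Plane) v := by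
    rw [hM', ContinuousLinearMap.coe_toContinuousLinearEquivOfDetNeZero]
    exact hasStrictFDerivAt_extChartAt_comp (hF.contMDiffAt v hv)
  refine ⟨hstrict.localInverse _ _ _, M'.symm, M.det, hdet, hstrict.to_localInverse,
    hstrict.localInverse_apply_image, ?_, fun x => ?_⟩
  · have hc := hstrict.localInverse_continuousAt
    rw [ContinuousAt, hstrict.localInverse_apply_image] at hc
    have hcF : ContinuousAt F v := (hF.contMDiffAt v hv).continuousAt
    have hstrip : stripDomain ∈ 𝓝 v := by
      have : Continuous fun z : Plane => z 0 := by fun_prop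
      filter_upwards [this.continuousAt.eventually (isOpen_Ioo.mem_nhds hv)] with z hz
      exact Ioo_subset_Icc_self hz
    filter_upwards [hstrict.eventually_right_inverse, hc.eventually hstrip,
      hc.eventually (hcF.eventually (extChartAt_source_mem_nhds (I := 𝓡∂ 2) (F v)))] with y h1 h2 h3
    refine ⟨?_, h2⟩
    conv_rhs => rw [← h1]
    exact ((extChartAt (𝓡∂ 2) (F v)).left_inv h3).symm
  · have h1 : M (M'.symm x) = x := M'.apply_symm_apply x
    have h2 := det2_map M e₀ (M'.symm x)
    rw [h1] at h2
    have h3 : det2 e₀ (M'.symm x) = (M'.symm x) 1 := by simp [det2, e₀]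
    rw [h2, h3]
    field_simp
    rfl

theorem IsSmoothTube.eventually_ray {F : Plane → S} (hF : IsSmoothTube F) {v : Plane} {p : S}
    (hv : v 0 ∈ Ioo (0 : ℝ) 1) (hv1 : v 1 = 0) (hp : F v = p) {x : Plane}
    (hx : det2 (planeDeriv F v e₀) x ≠ 0) :
    ∀ᶠ ε : ℝ in 𝓝[>] 0, ∃ z ∈ stripDomain,
      F z = (extChartAt (𝓡∂ 2) p).symm (extChartAt (𝓡∂ 2) p p + ε • x) ∧
      SignType.sign (z 1) =
        SignType.sign (det2 (planeDeriv F v e₀) x) := by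
  obtain ⟨ℓ, L, d, hd, hℓ, hℓp, hℓF, hL⟩ := hF.exists_chart_inverse hv hp
  have hg : HasFDerivAt (fun y => ℓ y 1)
      ((EuclideanSpace.proj (1 : Fin 2) : Plane →L[ℝ] ℝ).comp L) (extChartAt (𝓡∂ 2) p p) :=
    (EuclideanSpace.proj (1 : Fin 2) : Plane →L[ℝ] ℝ).hasFDerivAt.comp _ hℓ.hasFDerivAt
  have hL' : ((EuclideanSpace.proj (1 : Fin 2) : Plane →L[ℝ] ℝ).comp L) x =
    det2 (planeDeriv F v e₀) x / d := hL x
  have h1 := eventually_sign_ray hg (by rw [hℓp, hv1]) (x := x)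
    (by rw [hL']; exact div_ne_zero hx hd.ne')
  have h2 : Tendsto (fun ε : ℝ => extChartAt (𝓡∂ 2) p p + ε • x) (𝓝[>] 0)
      (𝓝 (extChartAt (𝓡∂ 2) p p)) :=
    (Continuous.tendsto' (by fun_prop) _ _ (by simp)).mono_left nhdsWithin_le_nhds
  filter_upwards [h1, h2.eventually hℓF] with ε h3 h4
  refine ⟨_, h4.2, h4.1, ?_⟩
  rw [h3, hL', div_eq_mul_inv, sign_mul, sign_pos (inv_pos.2 hd), mul_one]

/-- The restriction of the preferred chart at an interior point to a neighbourhood that it takes to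
an open subset of the plane. -/
theorem exists_interior_chart {p : S} (hp : p ∉ bd S) :
    ∃ e : OpenPartialHomeomorph S Plane, p ∈ e.source ∧
      (∀ q, e q = extChartAt (𝓡∂ 2) p q) ∧
      ∀ᶠ y in 𝓝 (extChartAt (𝓡∂ 2) p p), e ((extChartAt (𝓡∂ 2) p).symm y) = y := by
  set κ := extChartAt (𝓡∂ 2) p with hκ
  have hint : κ p ∈ interior κ.target := by
    have hI : (𝓡∂ 2).IsInteriorPoint p := by
      by_contra h
      exact hp ((ModelWithCorners.isBoundaryPoint_iff_not_isInteriorPoint p).2 h)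
    exact (ModelWithCorners.isInteriorPoint_iff).1 hI
  refine ⟨{ toFun := κ
            invFun := κ.symm
            source := κ.source ∩ κ ⁻¹' interior κ.target
            target := interior κ.target
            map_source' := fun q hq => hq.2
            map_target' := fun y hy => ?_
            left_inv' := fun q hq => κ.left_inv hq.1
            right_inv' := fun y hy => κ.right_inv (interior_subset hy)
            open_source := isOpen_extChartAt_preimage' p isOpen_interior
            open_target := isOpen_interior
            continuousOn_toFun := (continuousOn_extChartAt p).mono inter_subset_left
            continuousOn_invFun := (continuousOn_extChartAt_symm p).mono interior_subset }, ?_, ?_, ?_⟩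
  · refine ⟨κ.map_target (interior_subset hy), ?_⟩
    rw [mem_preimage, κ.right_inv (interior_subset hy)]
    exact hy
  · exact ⟨mem_extChartAt_source p, hint⟩
  · intro q; rfl
  · filter_upwards [isOpen_interior.mem_nhds hint] with y hy
    exact κ.right_inv (interior_subset hy)

/-- The heights in the two tubes vanish exactly on the respective arcs, and by transversality their
differentials are independent. Suitably rescaled, they form a chart whose derivative takes `v`, `u`
to the standard basis, so the ray along `σ • v + τ • u` enters the quadrant with signs `σ`, `τ`. -/
theorem exists_crossing_coordinates {F G : Plane → S} (hF : IsSmoothTube F) (hG : IsSmoothTube G)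
    {a b : Plane} {p : S} (ha : a 0 ∈ Ioo (0 : ℝ) 1) (ha1 : a 1 = 0) (hap : F a = p)
    (hb : b 0 ∈ Ioo (0 : ℝ) 1) (hb1 : b 1 = 0) (hbp : G b = p) {u v : Plane}
    (hu : u = planeDeriv F a e₀) (hv : v = planeDeriv G b e₀)
    (huv : det2 v u ≠ 0) :
    ∃ e : OpenPartialHomeomorph S (ℝ × ℝ), p ∈ e.source ∧ e p = 0 ∧
      (∀ᶠ q in 𝓝 p, ((e q).1 = 0 ↔ q ∈ arcOf F)) ∧ (∀ᶠ q in 𝓝 p, ((e q).2 = 0 ↔ q ∈ arcOf G)) ∧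
      ∀ σ τ : ℝ, σ ≠ 0 → τ ≠ 0 → ∀ᶠ ε : ℝ in 𝓝[>] 0,
        SignType.sign (e ((extChartAt (𝓡∂ 2) p).symm
          (extChartAt (𝓡∂ 2) p p + ε • (σ • v + τ • u)))).1 = SignType.sign σ ∧
        SignType.sign (e ((extChartAt (𝓡∂ 2) p).symm
          (extChartAt (𝓡∂ 2) p p + ε • (σ • v + τ • u)))).2 = SignType.sign τ := by
  have hpbd : p ∉ bd S := by
    rw [← hap, hF.mem_bd_iff a (Ioo_subset_Icc_self ha)]
    rintro (h | h)
    · exact ha.1.ne' h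
    · exact ha.2.ne h
  obtain ⟨κ, hκp, hκ, hκs⟩ := exists_interior_chart hpbd
  obtain ⟨ℓ, L, d, hd, hℓ, hℓp, hℓF, hL⟩ := hF.exists_chart_inverse ha hap
  obtain ⟨m, K, c, hc, hm, hmp, hmG, hK⟩ := hG.exists_chart_inverse hb hbp
  rw [← hu] at hL
  rw [← hv] at hK
  have huv' : det2 u v ≠ 0 := by rw [det2_swap]; exact neg_ne_zero.2 huv
  set y₀ := extChartAt (𝓡∂ 2) p p with hy₀
  -- With these factors the derivatives are `det2 u x / det2 u v` and `det2 v x / det2 v u`, which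
  -- are the coordinates of `x` in the basis `v`, `u`.
  let Ψ : Plane → ℝ × ℝ := fun y => (d / det2 u v * ℓ y 1, c / det2 v u * m y 1)
  let DΨ : Plane →L[ℝ] ℝ × ℝ :=
    ((det2 u v)⁻¹ • det2L u).prod ((det2 v u)⁻¹ • det2L v)
  let DI : ℝ × ℝ →L[ℝ] Plane :=
    (ContinuousLinearMap.fst ℝ ℝ ℝ).smulRight v + (ContinuousLinearMap.snd ℝ ℝ ℝ).smulRight u
  have hDI : ∀ z : ℝ × ℝ, DI z = z.1 • v + z.2 • u := fun z => by simp [DI]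
  have hDΨ : ∀ x, DΨ x = ((det2 u v)⁻¹ * det2 u x, (det2 v u)⁻¹ * det2 v x) := fun x => by
    simp [DΨ]
  have hl : Function.LeftInverse DI DΨ := by
    intro x
    rw [hDI, hDΨ, det2_swap v u]
    have key : ∀ i, det2 u x * v i - det2 v x * u i = det2 u v * x i := fun i => by
      fin_cases i <;> simp [det2] <;> ring
    ext i
    simp only [PiLp.add_apply, PiLp.smul_apply, smul_eq_mul, inv_neg]
    rw [← mul_right_inj' huv', ← key i]
    field_simp
    ring
  have hr : Function.RightInverse DI DΨ := by
    intro z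
    rw [hDI, hDΨ]
    simp only [det2_add_right, det2_smul_right, det2_self]
    ext <;> simp <;> field_simp
  let DE : Plane ≃L[ℝ] ℝ × ℝ := ContinuousLinearEquiv.equivOfInverse DΨ DI hl hr
  have hΨ : HasStrictFDerivAt Ψ (DE : Plane →L[ℝ] ℝ × ℝ) y₀ := by
    have h1 : HasStrictFDerivAt (fun y => ℓ y 1)
        ((EuclideanSpace.proj (1 : Fin 2) : Plane →L[ℝ] ℝ).comp L) y₀ :=
      (EuclideanSpace.proj (1 : Fin 2) : Plane →L[ℝ] ℝ).hasStrictFDerivAt.comp _ hℓ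
    have h2 : HasStrictFDerivAt (fun y => m y 1)
        ((EuclideanSpace.proj (1 : Fin 2) : Plane →L[ℝ] ℝ).comp K) y₀ :=
      (EuclideanSpace.proj (1 : Fin 2) : Plane →L[ℝ] ℝ).hasStrictFDerivAt.comp _ hm
    refine ((h1.const_mul (d / det2 u v)).prodMk (h2.const_mul (c / det2 v u))).congr_fderiv ?_
    refine ContinuousLinearMap.ext fun x => ?_
    have e1 := hL x
    have e2 := hK x
    show _ = DΨ x
    rw [hDΨ]
    ext
    · simp [e1]; field_simp
    · simp [e2]; field_simp
  have hΨ0 : Ψ y₀ = 0 := by simp [Ψ, hℓp, hmp, ha1, hb1]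
  let e := κ.trans (hΨ.toOpenPartialHomeomorph Ψ)
  have he : ∀ q, e q = Ψ (extChartAt (𝓡∂ 2) p q) := fun q => by simp [e, hκ]
  have hcont : Tendsto (extChartAt (𝓡∂ 2) p) (𝓝 p) (𝓝 y₀) := continuousAt_extChartAt p
  have hsrc := extChartAt_source_mem_nhds (I := 𝓡∂ 2) p
  refine ⟨e, ?_, by rw [he, ← hy₀, hΨ0], ?_, ?_, ?_⟩
  · simp only [e, OpenPartialHomeomorph.trans_source, mem_inter_iff, mem_preimage, hκ]
    exact ⟨hκp, hΨ.mem_toOpenPartialHomeomorph_source⟩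
  · filter_upwards [hcont.eventually hℓF, hsrc] with q h1 h2
    rw [(extChartAt (𝓡∂ 2) p).left_inv h2] at h1
    rw [he]
    conv_rhs => rw [← h1.1]
    rw [hF.mem_arcOf_iff h1.2]
    simp [Ψ, hd.ne', huv']
  · filter_upwards [hcont.eventually hmG, hsrc] with q h1 h2
    rw [(extChartAt (𝓡∂ 2) p).left_inv h2] at h1
    rw [he]
    conv_rhs => rw [← h1.1]
    rw [hG.mem_arcOf_iff h1.2]
    simp [Ψ, hc.ne', huv]
  · intro σ τ hσ hτ
    have hD : (DE : Plane →L[ℝ] ℝ × ℝ) (σ • v + τ • u) = (σ, τ) := by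
      rw [← hDI (σ, τ)]; exact hr (σ, τ)
    have g1 := eventually_sign_ray (x := σ • v + τ • u) hΨ.hasFDerivAt.fst
      (by simp [hΨ0]) (by rw [ContinuousLinearMap.comp_apply, hD]; exact hσ)
    have g2 := eventually_sign_ray (x := σ • v + τ • u) hΨ.hasFDerivAt.snd
      (by simp [hΨ0]) (by rw [ContinuousLinearMap.comp_apply, hD]; exact hτ)
    have h2 : Tendsto (fun ε : ℝ => y₀ + ε • (σ • v + τ • u)) (𝓝[>] 0) (𝓝 y₀) :=
      (Continuous.tendsto' (by fun_prop) _ _ (by simp)).mono_left nhdsWithin_le_nhds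
    filter_upwards [g1, g2, h2.eventually hκs] with ε h3 h4 h5
    rw [hκ] at h5
    rw [he, h5, h3, h4, ContinuousLinearMap.comp_apply, ContinuousLinearMap.comp_apply, hD]
    exact ⟨rfl, rfl⟩

theorem velocity_of_tube {F : Plane → S} {s : ℝ}
    (hF : MDifferentiableAt 𝓘(ℝ, Plane) (𝓡∂ 2) F !₂[s, 0]) :
    velocity (fun t => F !₂[t, 0]) s = planeDeriv F !₂[s, 0] e₀ := by
  have h1 : HasFDerivAt (fun t : ℝ => (!₂[t, 0] : Plane))
      ((ContinuousLinearMap.id ℝ ℝ).smulRight e₀) s := by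
    have h : (fun t : ℝ => (!₂[t, 0] : Plane)) = (ContinuousLinearMap.id ℝ ℝ).smulRight e₀ := by
      funext t
      ext i; fin_cases i <;> simp [e₀]
    rw [h]
    exact ContinuousLinearMap.hasFDerivAt _
  have h2 := hF.hasMFDerivAt.comp s h1.hasMFDerivAt
  rw [velocity]
  erw [h2.mfderiv]
  show planeDeriv F !₂[s, 0] (((ContinuousLinearMap.id ℝ ℝ).smulRight e₀) (1 : ℝ)) = _
  simp

end Smooth

/-! ### Arc systems: a balanced function that vanishes on the boundary vanishes off the arcs. -/

section ArcSystem

variable {S : Type*} [TopologicalSpace S] [ChartedSpace (EuclideanHalfSpace 2) S] {N : ℕ}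

/-- Two families of pairwise disjoint arcs, and a function `E` that is constant on the regions
which they cut out, vanishes on the boundary, and satisfies the cocycle condition at the
crossings. -/
structure IsArcSystem (Γ : Set S) (E : S → ℤ) (F G : Fin N → Plane → S) : Prop where
  left : ∀ i, IsSmoothTube (F i)
  right : ∀ j, IsSmoothTube (G j)
  left_disjoint : ∀ i j p, p ∈ arcOf (F i) → p ∈ arcOf (F j) → i = j
  right_disjoint : ∀ i j p, p ∈ arcOf (G i) → p ∈ arcOf (G j) → i = j
  mem_iff : ∀ p, p ∈ Γ ↔ (∃ i, p ∈ arcOf (F i)) ∨ ∃ j, p ∈ arcOf (G j)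
  constOff : ConstOff Γ E
  crossing : ∀ i j p, p ∈ arcOf (F i) → p ∈ arcOf (G j) →
    ∃ (e : OpenPartialHomeomorph S (ℝ × ℝ)) (n : SignType → SignType → ℤ),
      IsCrossing Γ E e p n ∧ (∀ᶠ q in 𝓝 p, ((e q).1 = 0 ↔ q ∈ arcOf (F i))) ∧
      ∀ᶠ q in 𝓝 p, ((e q).2 = 0 ↔ q ∈ arcOf (G j))
  crossing_interior : ∀ i j p, p ∈ arcOf (F i) → p ∈ arcOf (G j) → p ∉ bd S
  eq_zero : ∀ p ∈ bd S, p ∉ Γ → E p = 0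

theorem mem_arcOf {X : Type*} {F : Plane → X} {s : ℝ} (hs : s ∈ Icc (0 : ℝ) 1) :
    F !₂[s, 0] ∈ arcOf F :=
  ⟨s, hs, rfl⟩

theorem IsSmoothTube.mem_bd_core_iff {F : Plane → S} (hF : IsSmoothTube F) {s : ℝ}
    (hs : s ∈ Icc (0 : ℝ) 1) : F !₂[s, 0] ∈ bd S ↔ s = 0 ∨ s = 1 := by
  simpa using hF.mem_bd_iff !₂[s, 0] (by simpa [stripDomain] using hs)

theorem IsSmoothTube.injOn_core {F : Plane → S} (hF : IsSmoothTube F) :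
    InjOn (fun t => F !₂[t, 0]) (Icc 0 1) := fun s hs t ht hst => by
  have := hF.injOn (by simpa [stripDomain] using hs) (by simpa [stripDomain] using ht) hst
  simpa using congrArg (fun v : Plane => v 0) this

variable {Γ : Set S} {E : S → ℤ} {F G : Fin N → Plane → S}

theorem IsArcSystem.swap (h : IsArcSystem Γ E F G) : IsArcSystem Γ E G F where
  left := h.right
  right := h.left
  left_disjoint := h.right_disjoint
  right_disjoint := h.left_disjoint
  mem_iff p := by rw [h.mem_iff p, or_comm]
  constOff := h.constOff
  crossing i j p hi hj := by
    obtain ⟨e, n, h1, h2, h3⟩ := h.crossing j i p hj hi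
    refine ⟨_, _, h1.swap, ?_, ?_⟩
    · filter_upwards [h3] with q hq using by simpa using hq
    · filter_upwards [h2] with q hq using by simpa using hq
  crossing_interior i j p hi hj := h.crossing_interior j i p hj hi
  eq_zero := h.eq_zero

theorem IsArcSystem.arcOf_subset (h : IsArcSystem Γ E F G) (i : Fin N) : arcOf (F i) ⊆ Γ :=
  fun p hp => (h.mem_iff p).2 (Or.inl ⟨i, hp⟩)

variable [T2Space S]

/-- The arcs are compact, hence closed, and finite in number; those that miss `p` also miss a
neighbourhood of `p`. -/
theorem eventually_mem_arcOf_imp (hF : ∀ i, IsSmoothTube (F i)) (p : S) :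
    ∀ᶠ q in 𝓝 p, ∀ i, q ∈ arcOf (F i) → p ∈ arcOf (F i) := by
  rw [eventually_all]
  intro i
  by_cases hp : p ∈ arcOf (F i)
  · exact Eventually.of_forall fun _ _ => hp
  · filter_upwards [(hF i).tube.isCompact_core.isClosed.isOpen_compl.mem_nhds hp] with q hq hq'
    exact absurd hq' hq

theorem IsArcSystem.eventually_mem_arcOf (h : IsArcSystem Γ E F G) {i : Fin N} {p : S}
    (hp : p ∈ arcOf (F i)) (hG : ∀ j, p ∉ arcOf (G j)) :
    ∀ᶠ q in 𝓝 p, q ∈ Γ → q ∈ arcOf (F i) := by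
  filter_upwards [eventually_mem_arcOf_imp h.left p, eventually_mem_arcOf_imp h.right p]
    with q h1 h2 hq
  rcases (h.mem_iff q).1 hq with ⟨j, hj⟩ | ⟨j, hj⟩
  · rwa [h.left_disjoint i j p hp (h1 j hj)]
  · exact absurd (h2 j hj) (hG j)

/-- The tube fibre over an end of the arc lies in `bd S`, where `E` vanishes, and no arc of the
other family passes through that end. -/
theorem IsArcSystem.eventually_eq_zero_of_mem_bd (h : IsArcSystem Γ E F G) {i : Fin N} {p : S}
    (hp : p ∈ arcOf (F i)) (hbd : p ∈ bd S) : ∀ᶠ q in 𝓝 p, q ∉ Γ → E q = 0 := by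
  have hG : ∀ j, p ∉ arcOf (G j) := fun j hj => h.crossing_interior i j p hp hj hbd
  have hev := h.eventually_mem_arcOf hp hG
  obtain ⟨s, hs, rfl⟩ := hp
  have hs' := ((h.left i).mem_bd_core_iff hs).1 hbd
  refine (h.left i).tube.eventually_eq_zero h.constOff hs hev (h.arcOf_subset i) fun x hx => ?_
  refine h.eq_zero _ ?_ hx
  exact ((h.left i).mem_bd_iff _ (by simpa [stripDomain] using hs)).2 (by simpa using hs')

/-- The absence of a jump starts at the end of the arc on the boundary and spreads along it: through
free points because side values are locally constant, through crossings by the balance condition.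
Points are punctured because a crossing itself is not yet known to be good. -/
theorem IsArcSystem.eventually_goodAt (h : IsArcSystem Γ E F G) (i : Fin N) {s : ℝ}
    (hs : s ∈ Icc (0 : ℝ) 1) : ∀ᶠ s' in 𝓝[Icc (0 : ℝ) 1 \ {s}] s, GoodAt Γ E (F i !₂[s', 0]) := by
  have hle : ∀ s, 𝓝[Icc (0 : ℝ) 1 \ {s}] s ≤ 𝓝[Icc (0 : ℝ) 1] s :=
    fun s => nhdsWithin_mono _ sdiff_subset
  have hcont : ContinuousOn (fun t => F i !₂[t, 0]) (Icc 0 1) := (h.left i).tube.continuousOn_core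
  have hinj := (h.left i).injOn_core
  refine eventually_of_locally_iff (G := fun s' => GoodAt Γ E (F i !₂[s', 0])) ?_ ?_ hs
  · intro s hs
    by_cases hG : ∃ j, F i !₂[s, 0] ∈ arcOf (G j)
    · obtain ⟨j, hj⟩ := hG
      obtain ⟨e, n, h1, h2, -⟩ := h.crossing i j _ (mem_arcOf hs) hj
      refine ⟨_, h1.eventually_goodAt_iff hs rfl hcont hinj ?_⟩
      filter_upwards [(hcont s hs).eventually h2, self_mem_nhdsWithin] with s' h3 hs'
      exact h3.2 (mem_arcOf hs')
    · rw [not_exists] at hG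
      obtain ⟨P, hP⟩ := (h.left i).tube.exists_goodAt_iff h.constOff hs
        (h.eventually_mem_arcOf (mem_arcOf hs) hG) (h.arcOf_subset i)
      exact ⟨P, hle s hP⟩
  · have h0 : (0 : ℝ) ∈ Icc (0 : ℝ) 1 := by simp
    have hbd : F i !₂[0, 0] ∈ bd S := ((h.left i).mem_bd_core_iff h0).2 (Or.inl rfl)
    have := h.eventually_eq_zero_of_mem_bd (mem_arcOf h0) hbd
    have := hle 0 ((hcont 0 h0).eventually (eventually_eventually_nhds.2 this))
    filter_upwards [this] with s' hs' using ⟨0, hs'⟩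

/-- At a crossing, good points nearby on both arcs force all four quadrant values to agree. At other
points of the arc, goodness is inherited from its neighbours. -/
theorem IsArcSystem.goodAt_of_mem_left (h : IsArcSystem Γ E F G) {i : Fin N} {p : S}
    (hp : p ∈ arcOf (F i)) : GoodAt Γ E p := by
  by_cases hG : ∃ j, p ∈ arcOf (G j)
  · obtain ⟨j, hj⟩ := hG
    -- Stated for arbitrary families, so that it applies to both arcs through the crossing, by way
    -- of `IsArcSystem.swap`.
    have hne : ∀ {F G : Fin N → Plane → S} (i j : Fin N) (_ : IsArcSystem Γ E F G)
        {e : OpenPartialHomeomorph S (ℝ × ℝ)} {n : SignType → SignType → ℤ} (_ : p ∈ arcOf (F i))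
        (_ : IsCrossing Γ E e p n) (_ : ∀ᶠ q in 𝓝 p, ((e q).1 = 0 ↔ q ∈ arcOf (F i))),
        n 1 1 = n (-1) 1 := by
      intro F G i j h e n hp h1 h2
      obtain ⟨s, hs, rfl⟩ := hp
      have hcont : ContinuousOn (fun t => F i !₂[t, 0]) (Icc 0 1) :=
        (h.left i).tube.continuousOn_core
      have hinj := (h.left i).injOn_core
      have h3 := h1.eventually_goodAt_iff hs rfl hcont hinj (by
        filter_upwards [(hcont s hs).eventually h2, self_mem_nhdsWithin] with s' h3 hs'
        exact h3.2 (mem_arcOf hs'))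
      have := neBot_nhdsWithin_Icc_diff hs
      obtain ⟨s', h4, h5⟩ := (h3.and (h.eventually_goodAt i hs)).exists
      exact h4.1 h5
    obtain ⟨e, n, h1, h2, h3⟩ := h.crossing i j p hp hj
    refine h1.goodAt (hne i j h hp h1 h2) (hne j i h.swap hj h1.swap ?_)
    filter_upwards [h3] with q hq using by simpa using hq
  · rw [not_exists] at hG
    have hev := h.eventually_mem_arcOf hp hG
    obtain ⟨s, hs, rfl⟩ := hp
    obtain ⟨P, hP⟩ := (h.left i).tube.exists_goodAt_iff h.constOff hs hev (h.arcOf_subset i)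
    have := neBot_nhdsWithin_Icc_diff hs
    obtain ⟨s', h4, h5⟩ :=
      ((hP.filter_mono (nhdsWithin_mono s sdiff_subset)).and (h.eventually_goodAt i hs)).exists
    exact (hP.self_of_nhdsWithin hs).2 (h4.1 h5)

theorem IsArcSystem.mem_closure_of_mem_left (h : IsArcSystem Γ E F G) {i : Fin N} {p : S}
    (hp : p ∈ arcOf (F i)) : p ∈ closure Γᶜ := by
  by_cases hG : ∃ j, p ∈ arcOf (G j)
  · obtain ⟨j, hj⟩ := hG
    obtain ⟨e, n, h1, -, -⟩ := h.crossing i j p hp hj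
    exact h1.mem_closure_compl
  · rw [not_exists] at hG
    have hev := h.eventually_mem_arcOf hp hG
    obtain ⟨s, hs, rfl⟩ := hp
    exact (h.left i).tube.mem_closure_compl h.constOff hs hev

theorem IsArcSystem.isClosed (h : IsArcSystem Γ E F G) : IsClosed Γ := by
  have : Γ = (⋃ i, arcOf (F i)) ∪ ⋃ j, arcOf (G j) := by
    ext p; simp [h.mem_iff]
  rw [this]
  exact (isClosed_iUnion_of_finite fun i => (h.left i).tube.isCompact_core.isClosed).union
    (isClosed_iUnion_of_finite fun i => (h.right i).tube.isCompact_core.isClosed)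

/-- Density of the complement makes the local value in `GoodAt` unique. -/
theorem IsArcSystem.dense (h : IsArcSystem Γ E F G) (p : S) : p ∈ closure Γᶜ := by
  by_cases hp : p ∈ Γ
  · rcases (h.mem_iff p).1 hp with ⟨i, hi⟩ | ⟨j, hj⟩
    · exact h.mem_closure_of_mem_left hi
    · exact h.swap.mem_closure_of_mem_left hj
  · exact subset_closure hp

theorem IsArcSystem.eventually_eq (h : IsArcSystem Γ E F G) {p : S} (hp : p ∉ Γ) :
    ∀ᶠ q in 𝓝 p, q ∉ Γ → E q = E p := by
  have : LocallyConnectedSpace S := ChartedSpace.locallyConnectedSpace (EuclideanHalfSpace 2) S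
  have hopen := h.isClosed.isOpen_compl
  filter_upwards [connectedComponentIn_mem_nhds (hopen.mem_nhds hp)] with q hq _
  exact h.constOff _ isPreconnected_connectedComponentIn (connectedComponentIn_subset _ _) q hq p
    (mem_connectedComponentIn hp)

theorem IsArcSystem.goodAt (h : IsArcSystem Γ E F G) (p : S) : GoodAt Γ E p := by
  by_cases hp : p ∈ Γ
  · rcases (h.mem_iff p).1 hp with ⟨i, hi⟩ | ⟨j, hj⟩
    · exact h.goodAt_of_mem_left hi
    · exact h.swap.goodAt_of_mem_left hj
  · exact ⟨E p, h.eventually_eq hp⟩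

/-- Closedness is where the absence of jumps enters: near a limit point `E` has a single value, and
arbitrarily close there are points off `Γ` where it is 0. -/
theorem IsArcSystem.isClopen_zero (h : IsArcSystem Γ E F G) :
    IsClopen {p | ∀ᶠ q in 𝓝 p, q ∉ Γ → E q = 0} := by
  refine ⟨?_, isOpen_setOfPred_eventually_nhds⟩
  refine isClosed_of_closure_subset fun p hp => ?_
  obtain ⟨n, hn⟩ := h.goodAt p
  obtain ⟨p', h1, h2⟩ := mem_closure_iff_nhds.1 hp _ (eventually_eventually_nhds.2 hn)
  obtain ⟨q, hq, hqΓ⟩ := mem_closure_iff_nhds.1 (h.dense p') _ (h1.and h2)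
  have : n = 0 := by rw [← hq.1 hqΓ, hq.2 hqΓ]
  subst this
  exact hn

theorem IsArcSystem.eventually_eq_zero_bd (h : IsArcSystem Γ E F G) {p : S} (hp : p ∈ bd S) :
    ∀ᶠ q in 𝓝 p, q ∉ Γ → E q = 0 := by
  by_cases hpΓ : p ∈ Γ
  · rcases (h.mem_iff p).1 hpΓ with ⟨i, hi⟩ | ⟨j, hj⟩
    · exact h.eventually_eq_zero_of_mem_bd hi hp
    · exact h.swap.eventually_eq_zero_of_mem_bd hj hp
  · rw [← h.eq_zero p hp hpΓ]
    exact h.eventually_eq hpΓ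

/-- The clopen set `Z` contains the boundary and each arc `F i`, since an arc is connected and
begins on the boundary. A component of `S` outside `Z` would be compact and disjoint from the arcs
and the boundary, so the disk condition would make it homeomorphic to the noncompact plane. -/
theorem IsArcSystem.eq_zero_of_disks [CompactSpace S] (h : IsArcSystem Γ E F G)
    (hd : ∀ p ∈ (⋃ i, arcOf (F i))ᶜ,
      Nonempty (↥(connectedComponentIn (⋃ i, arcOf (F i))ᶜ p \ bd S) ≃ₜ Plane)) {p : S}
    (hp : p ∉ Γ) : E p = 0 := by
  set Z := {p | ∀ᶠ q in 𝓝 p, q ∉ Γ → E q = 0} with hZ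
  have hclopen : IsClopen Z := h.isClopen_zero
  by_contra hne
  have hpZ : p ∈ Zᶜ := fun hpZ => hne (Eventually.self_of_nhds hpZ hp)
  have harc : ∀ i, arcOf (F i) ⊆ Z := fun i => by
    have h0 : (0 : ℝ) ∈ Icc (0 : ℝ) 1 := by simp
    refine IsPreconnected.subset_isClopen
      (isPreconnected_Icc.image _ (h.left i).tube.continuousOn_core) hclopen
      ⟨F i !₂[0, 0], mem_arcOf h0, ?_⟩
    exact h.eventually_eq_zero_bd (((h.left i).mem_bd_core_iff h0).2 (Or.inl rfl))
  have hsub : connectedComponent p ⊆ Zᶜ :=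
    isPreconnected_connectedComponent.subset_isClopen hclopen.compl ⟨p, mem_connectedComponent, hpZ⟩
  have hA : Zᶜ ⊆ (⋃ i, arcOf (F i))ᶜ := compl_subset_compl.2 (iUnion_subset harc)
  have hcc : connectedComponentIn (⋃ i, arcOf (F i))ᶜ p = connectedComponent p := by
    refine Subset.antisymm ?_ ?_
    · exact isPreconnected_connectedComponentIn.subset_connectedComponent
        (mem_connectedComponentIn (hA hpZ))
    · exact isPreconnected_connectedComponent.subset_connectedComponentIn mem_connectedComponent
        (hsub.trans hA)
  have hdiff : connectedComponentIn (⋃ i, arcOf (F i))ᶜ p \ bd S = connectedComponent p := by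
    rw [hcc, sdiff_eq_left, disjoint_left]
    exact fun q hq hq' => hsub hq (h.eventually_eq_zero_bd hq')
  obtain ⟨f⟩ := hd p (hA hpZ)
  rw [hdiff] at f
  have : CompactSpace ↥(connectedComponent p) :=
    isCompact_iff_compactSpace.1 isClosed_connectedComponent.isCompact
  have : CompactSpace Plane := f.compactSpace
  exact noncompact_univ Plane isCompact_univ

end ArcSystem

/-! ### The tubes of the Heegaard diagram, obtained from the strips by shears and the monodromy. -/

section Tubes

variable {S : Type*} [TopologicalSpace S]

/-- The identification of `ℝ × ℝ` with the Euclidean plane. -/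
def toPlane : ℝ × ℝ ≃ₜ Plane where
  toFun z := !₂[z.1, z.2]
  invFun v := (v 0, v 1)
  left_inv z := by simp
  right_inv v := eta_plane v
  continuous_toFun := by
    refine (PiLp.continuous_toLp 2 _).comp (continuous_pi fun i => ?_)
    fin_cases i <;> simp <;> fun_prop
  continuous_invFun := by fun_prop

theorem isTube_of_isOpenEmbedding {F : Plane → S}
    (h : IsOpenEmbedding (stripDomain.domRestrict F)) : IsTube fun z : ℝ × ℝ => F !₂[z.1, z.2] where
  injOn z hz w hw hzw := by
    have := h.injective (a₁ := ⟨toPlane z, mem_band.1 hz⟩) (a₂ := ⟨toPlane w, mem_band.1 hw⟩) hzw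
    exact toPlane.injective (Subtype.ext_iff.1 this)
  map_nhds z hz := by
    have hz' : toPlane z ∈ stripDomain := mem_band.1 hz
    have h1 : map toPlane (𝓝[band] z) = 𝓝[stripDomain] (toPlane z) := by
      rw [toPlane.isEmbedding.map_nhdsWithin_eq]
      congr 1
      ext v
      constructor
      · rintro ⟨w, hw, rfl⟩
        exact mem_band.1 hw
      · intro hv
        exact ⟨toPlane.symm v, mem_band.2 hv, toPlane.apply_symm_apply v⟩
    show map (F ∘ toPlane) _ = 𝓝 (F (toPlane z))
    rw [← map_map, h1, nhdsWithin_eq_map_subtype_coe hz', map_map]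
    exact h.map_nhds_eq ⟨_, hz'⟩

/-- The shear is a homeomorphism that preserves the band and takes the core line to the graph of
`f`; it turns the tube of $a_i$ into one of $b_i$. -/
theorem IsTube.shear {T : ℝ × ℝ → S} (hT : IsTube T) {f : ℝ → ℝ} (hf : Continuous f) :
    IsTube fun z : ℝ × ℝ => T (z.1, z.2 + f z.1) := by
  let σ : ℝ × ℝ ≃ₜ ℝ × ℝ :=
    { toFun := fun z => (z.1, z.2 + f z.1)
      invFun := fun z => (z.1, z.2 - f z.1)
      left_inv := fun z => by simp
      right_inv := fun z => by simp
      continuous_toFun := by fun_prop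
      continuous_invFun := by fun_prop }
  have hσ : ∀ z, z ∈ band → σ z ∈ band := fun z hz => mem_band.2 (mem_band.1 hz)
  refine ⟨fun z hz w hw hzw => σ.injective (hT.injOn (hσ z hz) (hσ w hw) hzw), fun z hz => ?_⟩
  show map (T ∘ σ) _ = 𝓝 (T (σ z))
  rw [← map_map, σ.isEmbedding.map_nhdsWithin_eq, ← hT.map_nhds _ (hσ z hz)]
  congr 2
  ext w
  constructor
  · rintro ⟨z, hz, rfl⟩
    exact hσ z hz
  · intro hw
    exact ⟨σ.symm w, mem_band.2 (mem_band.1 hw), σ.apply_symm_apply w⟩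

variable [ChartedSpace (EuclideanHalfSpace 2) S]

/-- The shear of the plane along the graph of `f`. -/
def shear (f : ℝ → ℝ) (v : Plane) : Plane := !₂[v 0, v 1 + f (v 0)]

/-- The derivative of a shear. -/
def shearL (c : ℝ) : Plane →L[ℝ] Plane :=
  ContinuousLinearMap.id ℝ Plane +
    (c • (EuclideanSpace.proj (0 : Fin 2) : Plane →L[ℝ] ℝ)).smulRight (!₂[0, 1] : Plane)

theorem shearL_apply (c : ℝ) (x : Plane) : shearL c x = !₂[x 0, x 1 + c * x 0] := by
  ext i; fin_cases i <;> simp [shearL]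

theorem det_shearL (c : ℝ) : (shearL c).det = 1 := by
  have h := det2_map (shearL c) !₂[1, 0] !₂[0, 1]
  simp only [shearL_apply] at h
  simpa [det2] using h.symm

theorem hasFDerivAt_shear {f : ℝ → ℝ} {v : Plane} (hf : DifferentiableAt ℝ f (v 0)) :
    HasFDerivAt (shear f) (shearL (deriv f (v 0))) v := by
  have h0 : HasFDerivAt (fun x : Plane => x 0) (EuclideanSpace.proj (0 : Fin 2) : Plane →L[ℝ] ℝ) v :=
    (EuclideanSpace.proj (0 : Fin 2) : Plane →L[ℝ] ℝ).hasFDerivAt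
  have h1 : HasFDerivAt (fun x : Plane => f (x 0))
      (deriv f (v 0) • (EuclideanSpace.proj (0 : Fin 2) : Plane →L[ℝ] ℝ)) v :=
    hf.hasDerivAt.comp_hasFDerivAt v h0
  have h2 := (hasFDerivAt_id v).add (h1.smul_const (!₂[0, 1] : Plane))
  refine h2.congr_of_eventuallyEq (Eventually.of_forall fun x => ?_)
  ext i; fin_cases i <;> simp [shear]

theorem contDiff_shear {f : ℝ → ℝ} {n : WithTop ℕ∞} (hf : ContDiff ℝ n f) :
    ContDiff ℝ n (shear f) := by
  have h0 : ContDiff ℝ n (fun x : Plane => x 0) :=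
    (EuclideanSpace.proj (0 : Fin 2) : Plane →L[ℝ] ℝ).contDiff
  have : shear f = fun x : Plane => x + f (x 0) • (!₂[0, 1] : Plane) := by
    funext x
    ext i; fin_cases i <;> simp [shear]
  rw [this]
  exact contDiff_id.add ((hf.comp h0).smul contDiff_const)

theorem planeDeriv_shear {F : Plane → S} {f : ℝ → ℝ} (hf : ContDiff ℝ ∞ f) {v : Plane}
    (hF : MDifferentiableAt 𝓘(ℝ, Plane) (𝓡∂ 2) F (shear f v)) :
    planeDeriv (F ∘ shear f) v = (planeDeriv F (shear f v)).comp (shearL (deriv f (v 0))) := by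
  have h1 := (hasFDerivAt_shear (v := v) (hf.differentiable (by simp) (v 0))).hasMFDerivAt
  exact (hF.hasMFDerivAt.comp v h1).mfderiv

theorem det_comp_plane (A C : Plane →L[ℝ] Plane) : (A.comp C).det = A.det * C.det :=
  LinearMap.det_comp _ _

theorem IsSmoothTube.shear {F : Plane → S} (hF : IsSmoothTube F) {f : ℝ → ℝ}
    (hf : ContDiff ℝ ∞ f) : IsSmoothTube (F ∘ shear f) where
  tube := by simpa [OpenBook.shear, Function.comp_def] using hF.tube.shear hf.continuous
  contMDiffAt v hv := by
    have h1 : ContMDiffAt 𝓘(ℝ, Plane) 𝓘(ℝ, Plane) 1 (OpenBook.shear f) v :=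
      ((contDiff_shear hf).of_le (by simp)).contDiffAt.contMDiffAt
    exact (hF.contMDiffAt (OpenBook.shear f v) (by simpa [OpenBook.shear] using hv)).comp v h1
  det_pos v hv := by
    have hv' : OpenBook.shear f v 0 ∈ Ioo (0 : ℝ) 1 := by simpa [OpenBook.shear] using hv
    rw [planeDeriv_shear hf ((hF.contMDiffAt _ hv').mdifferentiableAt one_ne_zero),
      det_comp_plane, det_shearL, mul_one]
    exact hF.det_pos _ hv'
  mem_bd_iff v hv := by
    simpa [OpenBook.shear] using
      hF.mem_bd_iff (OpenBook.shear f v) (by simpa [OpenBook.shear, stripDomain] using hv)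

variable {N : ℕ} {B : OpenBookDiagram S N} (H : HeegaardChoice B)

/-- As `φ` is injective and fixes the boundary pointwise, no interior point can land there. -/
theorem OpenBookDiagram.φ_mem_bd_iff (B : OpenBookDiagram S N) (p : S) :
    B.φ p ∈ bd S ↔ p ∈ bd S := by
  constructor
  · intro h
    have h1 : B.φ p = p := B.φ.injective (B.φ_boundary _ h)
    rwa [h1] at h
  · intro h
    rwa [B.φ_boundary p h]

theorem IsSmoothTube.monodromy (B : OpenBookDiagram S N) {F : Plane → S} (hF : IsSmoothTube F) :
    IsSmoothTube (B.φ ∘ F) where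
  tube := by
    refine ⟨fun z hz w hw hzw => hF.tube.injOn hz hw (B.φ.injective hzw), fun z hz => ?_⟩
    have h1 := B.φ.toHomeomorph.map_nhds_eq (F !₂[z.1, z.2])
    rw [← hF.tube.map_nhds z hz, map_map] at h1
    exact h1
  contMDiffAt v hv := by
    have h1 : ContMDiffAt (𝓡∂ 2) (𝓡∂ 2) 1 B.φ (F v) :=
      (B.φ.contMDiff.of_le (by simp)).contMDiffAt
    exact h1.comp v (hF.contMDiffAt v hv)
  det_pos v hv := by
    have h1 := (B.φ.mdifferentiable (by simp) (F v)).hasMFDerivAt.comp v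
      ((hF.contMDiffAt v hv).mdifferentiableAt one_ne_zero).hasMFDerivAt
    obtain ⟨A, hA, h2⟩ : ∃ A : Plane →L[ℝ] Plane, 0 < A.det ∧
        planeDeriv (B.φ ∘ F) v = A.comp (planeDeriv F v) := ⟨_, B.φ_orient _, h1.mfderiv⟩
    rw [h2, det_comp_plane]
    exact mul_pos hA (hF.det_pos v hv)
  mem_bd_iff v hv := by
    rw [Function.comp_apply, B.φ_mem_bd_iff]
    exact hF.mem_bd_iff v hv

namespace HeegaardChoice

theorem stripDomain_mem_nhds {v : Plane} (hv : v 0 ∈ Ioo (0 : ℝ) 1) : stripDomain ∈ 𝓝 v := by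
  have : Continuous fun z : Plane => z 0 := by fun_prop
  filter_upwards [this.continuousAt.eventually (isOpen_Ioo.mem_nhds hv)] with z hz
  exact Ioo_subset_Icc_self hz

theorem isSmoothTube_strip (i : Fin N) : IsSmoothTube (H.strip i) where
  tube := isTube_of_isOpenEmbedding (H.strip_embedding i)
  contMDiffAt v hv :=
    ((H.strip_smooth i).contMDiffAt (stripDomain_mem_nhds hv)).of_le (by simp)
  det_pos v hv := by
    have := H.strip_orient i v (Ioo_subset_Icc_self hv)
    rwa [mfderivWithin_of_mem_nhds (stripDomain_mem_nhds hv)] at this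
  mem_bd_iff := H.strip_proper i

/-- The tubular neighbourhood of the part of `β_j` on a page. -/
def bTube : Page → Fin N → Plane → S
  | .half, j => H.strip j ∘ shear (H.f j)
  | .zero, j => B.φ ∘ (H.strip j ∘ shear (H.f j))

theorem isSmoothTube_bTube (P : Page) (j : Fin N) : IsSmoothTube (H.bTube P j) := by
  cases P
  · exact (H.isSmoothTube_strip j).shear (H.f_smooth j)
  · exact ((H.isSmoothTube_strip j).shear (H.f_smooth j)).monodromy B

theorem bOn_eq (P : Page) (j : Fin N) : H.bOn P j = fun t => H.bTube P j !₂[t, 0] := by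
  funext t
  cases P <;> simp [bOn, bTube, b, shear]

theorem arcOf_strip (i : Fin N) : arcOf (H.strip i) = B.a i '' Icc 0 1 :=
  image_congr fun t ht => H.strip_arc i t ht

theorem arcOf_bTube (P : Page) (j : Fin N) : arcOf (H.bTube P j) = H.bOn P j '' Icc 0 1 := by
  rw [bOn_eq]; rfl

theorem velocity_a (i : Fin N) {s : ℝ} (hs : s ∈ Ioo (0 : ℝ) 1) :
    velocity (B.a i) s = planeDeriv (H.strip i) !₂[s, 0] e₀ := by
  have hev : B.a i =ᶠ[𝓝 s] fun t => H.strip i !₂[t, 0] := by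
    filter_upwards [isOpen_Ioo.mem_nhds hs] with t ht
    exact (H.strip_arc i t (Ioo_subset_Icc_self ht)).symm
  rw [← velocity_of_tube (((H.isSmoothTube_strip i).contMDiffAt !₂[s, 0]
    (by simpa using hs)).mdifferentiableAt one_ne_zero)]
  unfold velocity
  rw [hev.mfderiv_eq]
  rfl

theorem velocity_bOn (P : Page) (j : Fin N) {t : ℝ} (ht : t ∈ Ioo (0 : ℝ) 1) :
    velocity (H.bOn P j) t = planeDeriv (H.bTube P j) !₂[t, 0] e₀ := by
  rw [bOn_eq]
  exact velocity_of_tube (((H.isSmoothTube_bTube P j).contMDiffAt !₂[t, 0]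
    (by simpa using ht)).mdifferentiableAt one_ne_zero)

theorem strip_index_unique {i j : Fin N} {v w : Plane} (hv : v ∈ stripDomain)
    (hw : w ∈ stripDomain) (h : H.strip i v = H.strip j w) : i = j := by
  by_contra hne
  exact disjoint_left.1 (H.strip_disjoint hne) ⟨v, hv, rfl⟩ ⟨w, hw, h.symm⟩

theorem shear_mem {f : ℝ → ℝ} {v : Plane} (hv : v ∈ stripDomain) : shear f v ∈ stripDomain := by
  simpa [shear, stripDomain] using hv

theorem mk_mem {s x : ℝ} (hs : s ∈ Icc (0 : ℝ) 1) : (!₂[s, x] : Plane) ∈ stripDomain := by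
  simpa [stripDomain] using hs

theorem arcOf_strip_disjoint (i j : Fin N) (p : S) (hi : p ∈ arcOf (H.strip i))
    (hj : p ∈ arcOf (H.strip j)) : i = j := by
  obtain ⟨s, hs, rfl⟩ := hi
  obtain ⟨t, ht, h⟩ := hj
  exact H.strip_index_unique (mk_mem hs) (mk_mem ht) h.symm

theorem arcOf_bTube_disjoint (P : Page) (i j : Fin N) (p : S) (hi : p ∈ arcOf (H.bTube P i))
    (hj : p ∈ arcOf (H.bTube P j)) : i = j := by
  obtain ⟨s, hs, rfl⟩ := hi
  obtain ⟨t, ht, h⟩ := hj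
  cases P
  · exact H.strip_index_unique (shear_mem (mk_mem hs)) (shear_mem (mk_mem ht)) h.symm
  · exact H.strip_index_unique (shear_mem (mk_mem hs)) (shear_mem (mk_mem ht))
      (B.φ.injective h.symm)

/-- The union of the arcs `a_i` and of the parts of the `β`-curves on a page. -/
def arcsOn (P : Page) : Set S := B.arcs ∪ ⋃ j, arcOf (H.bTube P j)

theorem arcs_eq : B.arcs = ⋃ i, arcOf (H.strip i) := by
  simp only [OpenBookDiagram.arcs, arcOf_strip]

theorem mem_arcsOn_iff (P : Page) (p : S) :
    p ∈ H.arcsOn P ↔ (∃ i, p ∈ arcOf (H.strip i)) ∨ ∃ j, p ∈ arcOf (H.bTube P j) := by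
  simp [arcsOn, H.arcs_eq]

/-- The monodromy is the identity on the boundary, so $b_j$ and $\varphi(b_j)$ have the same points
there. Hence a point of the gluing curve may be tested on either page. -/
theorem mem_arcOf_bTube_of_mem_bd (P P' : Page) (j : Fin N) {p : S} (hp : p ∈ bd S) :
    p ∈ arcOf (H.bTube P j) → p ∈ arcOf (H.bTube P' j) := by
  have key : p ∈ arcOf (H.bTube .zero j) ↔ p ∈ arcOf (H.bTube .half j) := by
    constructor
    · rintro ⟨t, ht, h⟩
      refine ⟨t, ht, ?_⟩
      have h1 : B.φ (H.bTube .half j !₂[t, 0]) = B.φ p := by rw [B.φ_boundary p hp]; exact h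
      exact B.φ.injective h1
    · rintro ⟨t, ht, h⟩
      refine ⟨t, ht, ?_⟩
      have h1 : B.φ (H.bTube .half j !₂[t, 0]) = B.φ p := congrArg B.φ h
      rw [B.φ_boundary p hp] at h1
      exact h1
  cases P <;> cases P' <;> simp [key]

end HeegaardChoice

theorem incl_eq_iff {P P' : Page} {p p' : S} :
    (P.incl p : Double S) = P'.incl p' ↔ (P = P' ∧ p = p') ∨ (p = p' ∧ p ∈ bd S) := by
  cases P <;> cases P' <;> simp only [Page.incl, Quotient.eq] <;>
    change (_ ∨ _) ↔ _ <;> simp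

/-! ### Multiplicities as functions on the pages. -/

namespace HeegaardChoice

theorem incl_mem_curves_iff (P : Page) (p : S) : P.incl p ∈ H.curves ↔ p ∈ H.arcsOn P := by
  rw [mem_arcsOn_iff]
  simp only [curves, mem_union, mem_iUnion, alpha, beta, arcOf_strip, arcOf_bTube]
  constructor
  · rintro (⟨i, P', t, ht, h⟩ | ⟨j, P', t, ht, h⟩)
    · left
      refine ⟨i, t, ht, ?_⟩
      rcases incl_eq_iff.1 h with h | h
      · exact h.2
      · exact h.1
    · right
      refine ⟨j, ?_⟩
      rcases incl_eq_iff.1 h with ⟨rfl, h'⟩ | ⟨h', hbd⟩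
      · exact ⟨t, ht, h'⟩
      · rw [← arcOf_bTube]
        refine H.mem_arcOf_bTube_of_mem_bd P' P j (h' ▸ hbd) ?_
        rw [arcOf_bTube]
        exact ⟨t, ht, h'⟩
  · rintro (⟨i, t, ht, h⟩ | ⟨j, t, ht, h⟩)
    · exact Or.inl ⟨i, P, t, ht, congrArg P.incl h⟩
    · exact Or.inr ⟨j, P, t, ht, congrArg P.incl h⟩

theorem continuous_incl (P : Page) : Continuous (P.incl : S → Double S) := by
  cases P
  · exact continuous_quotient_mk'.comp continuous_inl
  · exact continuous_quotient_mk'.comp continuous_inr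

variable {H}

theorem mult_eq_of_mk_eq (D : H.Chain) {p q : Double S} (hp : p ∈ H.curvesᶜ) (hq : q ∈ H.curvesᶜ)
    (h : (ConnectedComponents.mk ⟨p, hp⟩ : H.Region) = ConnectedComponents.mk ⟨q, hq⟩) :
    mult D p = mult D q := by
  unfold mult
  rw [dif_pos hp, dif_pos hq]
  by_cases h1 : H.Pointed (ConnectedComponents.mk ⟨q, hq⟩)
  · rw [dif_pos h1, dif_pos (h ▸ h1)]
  · rw [dif_neg h1, dif_neg (h ▸ h1)]
    congr 1
    exact Subtype.ext h

/-- The inclusion of a page is continuous, so a connected set off the curves of the page lands in a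
single region. -/
theorem constOff_mult (D : H.Chain) (P : Page) :
    ConstOff (H.arcsOn P) fun p => mult D (P.incl p) := by
  intro X hX hXΓ p hp q hq
  have hmem : ∀ r ∈ X, P.incl r ∈ H.curvesᶜ := fun r hr hc =>
    hXΓ hr ((H.incl_mem_curves_iff P r).1 hc)
  refine mult_eq_of_mk_eq D (hmem p hp) (hmem q hq) ?_
  have hY : IsPreconnected (Subtype.val ⁻¹' (P.incl '' X) : Set ↥(H.curvesᶜ)) := by
    rw [← IsInducing.subtypeVal.isPreconnected_image, Subtype.image_preimage_coe,
      inter_eq_right.2 (by rintro _ ⟨r, hr, rfl⟩; exact hmem r hr)]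
    exact hX.image _ (continuous_incl P).continuousOn
  rw [ConnectedComponents.coe_eq_coe']
  exact hY.subset_connectedComponent ⟨q, hq, rfl⟩ ⟨p, hp, rfl⟩

theorem mult_of_mem_Z (D : H.Chain) {z : S} (hz : z ∈ H.Z) : mult D (Page.half.incl z) = 0 := by
  unfold mult
  split_ifs with h1 h2
  · rfl
  · exact absurd ⟨_, rfl, z, hz, rfl⟩ h2
  · rfl

theorem mult_of_mem_arcsOn (D : H.Chain) (P : Page) {p : S} (hp : p ∈ H.arcsOn P) :
    mult D (P.incl p) = 0 := by
  unfold mult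
  rw [dif_neg fun h => h ((H.incl_mem_curves_iff P p).2 hp)]

end HeegaardChoice

end Tubes

/-! ### Pushing a cut-open strip off the thin strip. -/

section Push

/-- A map that pushes the complement of the line `x = 0` off the region between that line and the
graph of `f`, and fixes the points far from the line. -/
def push (f : ℝ → ℝ) (z : ℝ × ℝ) : ℝ × ℝ :=
  -- Adding a strictly positive height to `f` puts the image strictly beyond the graph; capping that
  -- height at 1 makes the map the identity far away. The two formulas need not agree on the line
  -- itself, where the surface is cut.
  if 0 < z.2 then (z.1, max z.2 (f z.1 + min z.2 1)) else (z.1, min z.2 (f z.1 + max z.2 (-1)))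

theorem push_fst (f : ℝ → ℝ) (z : ℝ × ℝ) : (push f z).1 = z.1 := by
  unfold push; split_ifs <;> rfl

theorem push_mem_band {f : ℝ → ℝ} {z : ℝ × ℝ} (hz : z ∈ band) : push f z ∈ band := by
  rw [mem_band, push_fst]; exact mem_band.1 hz

/-- The points of the plane that lie beyond the graph of `f`, as seen from the line `x = 0`. -/
def Beyond (f : ℝ → ℝ) (z : ℝ × ℝ) : Prop :=
  (0 < z.2 ∧ f z.1 < z.2) ∨ (z.2 < 0 ∧ z.2 < f z.1)

theorem beyond_push {f : ℝ → ℝ} {z : ℝ × ℝ} (hz : z.2 ≠ 0) : Beyond f (push f z) := by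
  unfold push
  split_ifs with h
  · left
    have : 0 < min z.2 1 := lt_min h one_pos
    exact ⟨lt_max_of_lt_left h, lt_max_of_lt_right (by dsimp only; linarith)⟩
  · right
    have h' : z.2 < 0 := lt_of_le_of_ne (not_lt.1 h) hz
    have : max z.2 (-1) < 0 := max_lt h' (by norm_num)
    exact ⟨min_lt_of_left_lt h', min_lt_of_right_lt (by dsimp only; linarith)⟩

theorem push_eq_self {f : ℝ → ℝ} {z : ℝ × ℝ} {M : ℝ} (hM : |f z.1| ≤ M) (hz : M + 1 < |z.2|) :
    push f z = z := by
  have h1 := abs_le.1 hM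
  have h0 : 0 ≤ M := (abs_nonneg _).trans hM
  unfold push
  split_ifs with h
  · rw [abs_of_pos h] at hz
    refine Prod.ext rfl (max_eq_left ?_)
    have := min_le_right z.2 1
    linarith
  · rw [abs_of_nonpos (not_lt.1 h)] at hz
    refine Prod.ext rfl (min_eq_left ?_)
    have := le_max_right z.2 (-1)
    linarith

theorem continuousAt_push {f : ℝ → ℝ} (hf : Continuous f) {z : ℝ × ℝ} (hz : z.2 ≠ 0) :
    ContinuousAt (push f) z := by
  rcases lt_or_gt_of_ne hz with h | h
  · have h1 : Continuous fun z : ℝ × ℝ => (z.1, min z.2 (f z.1 + max z.2 (-1))) := by fun_prop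
    refine h1.continuousAt.congr ?_
    filter_upwards [continuous_snd.continuousAt.eventually (gt_mem_nhds h)] with w hw
    rw [push, if_neg (not_lt.2 hw.le)]
  · have h1 : Continuous fun z : ℝ × ℝ => (z.1, max z.2 (f z.1 + min z.2 1)) := by fun_prop
    refine h1.continuousAt.congr ?_
    filter_upwards [continuous_snd.continuousAt.eventually (lt_mem_nhds h)] with w hw
    rw [push, if_pos hw]

end Push

/-! ### The page $S_{1/2}$: multiplicities outside and inside the thin strips. -/

namespace HeegaardChoice

variable {S : Type*} [TopologicalSpace S] [ChartedSpace (EuclideanHalfSpace 2) S]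
variable {N : ℕ} {B : OpenBookDiagram S N} (H : HeegaardChoice B)

/-- The tubular neighbourhood of `a_i`, in the coordinates of `ℝ × ℝ`. -/
def stripT (i : Fin N) (z : ℝ × ℝ) : S := H.strip i !₂[z.1, z.2]

theorem isTube_stripT (i : Fin N) : IsTube (H.stripT i) := (H.isSmoothTube_strip i).tube

theorem stripT_unique {i j : Fin N} {z w : ℝ × ℝ} (hz : z ∈ band) (hw : w ∈ band)
    (h : H.stripT i z = H.stripT j w) : i = j ∧ z = w := by
  obtain rfl := H.strip_index_unique (mk_mem (mem_band.1 hz)) (mk_mem (mem_band.1 hw)) h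
  exact ⟨rfl, (H.isTube_stripT i).injOn hz hw h⟩

theorem stripT_mem_arcs_iff {i : Fin N} {z : ℝ × ℝ} (hz : z ∈ band) :
    H.stripT i z ∈ B.arcs ↔ z.2 = 0 := by
  rw [H.arcs_eq, mem_iUnion, ← (H.isTube_stripT i).mem_core_iff hz]
  constructor
  · rintro ⟨j, t, ht, h⟩
    obtain ⟨rfl, -⟩ := H.stripT_unique (z := (t, 0)) (mem_band.2 ht) hz h
    exact ⟨t, ht, h⟩
  · intro h
    exact ⟨i, h⟩

theorem stripT_mem_arcsOn_half_iff {i : Fin N} {z : ℝ × ℝ} (hz : z ∈ band) :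
    H.stripT i z ∈ H.arcsOn .half ↔ z.2 = 0 ∨ z.2 = H.f i z.1 := by
  rw [arcsOn, mem_union, H.stripT_mem_arcs_iff hz, mem_iUnion]
  refine or_congr_right ?_
  constructor
  · rintro ⟨j, t, ht, h⟩
    have h' : H.stripT j (t, H.f j t) = H.stripT i z := by
      rw [← h]; simp [stripT, bTube, shear]
    obtain ⟨rfl, rfl⟩ := H.stripT_unique (mem_band.2 ht) hz h'
    rfl
  · intro h
    refine ⟨i, z.1, mem_band.1 hz, ?_⟩
    simp [stripT, bTube, shear, h]

/-- The points of the page that lie outside the closed thin strips. -/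
def Outer (p : S) : Prop := ∀ i, ∀ z ∈ band, H.stripT i z = p → Beyond (H.f i) z

theorem not_mem_arcsOn_of_outer {p : S} (hp : H.Outer p) : p ∉ H.arcsOn .half := by
  intro h
  obtain ⟨i, z, hz, rfl⟩ : ∃ i, ∃ z ∈ band, H.stripT i z = p := by
    rcases (H.mem_arcsOn_iff _ p).1 h with ⟨i, t, ht, h⟩ | ⟨i, t, ht, h⟩
    · exact ⟨i, (t, 0), mem_band.2 ht, h⟩
    · refine ⟨i, (t, H.f i t), mem_band.2 ht, ?_⟩
      rw [← h]; simp [stripT, bTube, shear]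
  have h1 := hp i z hz rfl
  rw [H.stripT_mem_arcsOn_half_iff hz] at h
  rcases h1 with h1 | h1 <;> rcases h with h | h <;> linarith [h1.1, h1.2]

theorem outer_stripT_iff {i : Fin N} {z : ℝ × ℝ} (hz : z ∈ band) :
    H.Outer (H.stripT i z) ↔ Beyond (H.f i) z := by
  constructor
  · intro h
    exact h i z hz rfl
  · intro h j w hw hjw
    obtain ⟨rfl, rfl⟩ := H.stripT_unique hw hz hjw
    exact h

open Classical in
/-- The map of the page, cut open along the arcs `a_i`, that pushes it off the thin strips. -/
def pushOff (p : S) : S :=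
  if h : ∃ iz : Fin N × (ℝ × ℝ), iz.2 ∈ band ∧ H.stripT iz.1 iz.2 = p then
    H.stripT h.choose.1 (push (H.f h.choose.1) h.choose.2)
  else p

theorem pushOff_stripT {i : Fin N} {z : ℝ × ℝ} (hz : z ∈ band) :
    H.pushOff (H.stripT i z) = H.stripT i (push (H.f i) z) := by
  have h : ∃ iz : Fin N × (ℝ × ℝ), iz.2 ∈ band ∧ H.stripT iz.1 iz.2 = H.stripT i z :=
    ⟨(i, z), hz, rfl⟩
  rw [pushOff, dif_pos h]
  obtain ⟨h1, h2⟩ := H.stripT_unique h.choose_spec.1 hz h.choose_spec.2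
  rw [h2, h1]

theorem pushOff_of_forall {p : S} (h : ∀ i, ∀ z ∈ band, H.stripT i z ≠ p) : H.pushOff p = p := by
  rw [pushOff, dif_neg]
  rintro ⟨iz, h1, h2⟩
  exact h _ _ h1 h2

theorem outer_pushOff {p : S} (hp : p ∈ B.arcsᶜ) : H.Outer (H.pushOff p) := by
  by_cases h : ∃ i, ∃ z ∈ band, H.stripT i z = p
  · obtain ⟨i, z, hz, rfl⟩ := h
    rw [H.pushOff_stripT hz, H.outer_stripT_iff (push_mem_band hz)]
    exact beyond_push fun h0 => hp ((H.stripT_mem_arcs_iff hz).2 h0)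
  · push Not at h
    rw [H.pushOff_of_forall h]
    intro i z hz h'
    exact absurd h' (h i z hz)

/-- Inside a tube this is continuity of `push` off the core. A point outside all tubes has a
neighbourhood that misses the compact parts of the tubes where points are moved, so the map is the
identity there. -/
theorem continuousOn_pushOff [T2Space S] : ContinuousOn H.pushOff B.arcsᶜ := by
  intro p hp
  refine ContinuousAt.continuousWithinAt ?_
  by_cases h : ∃ i, ∃ z ∈ band, H.stripT i z = p
  · obtain ⟨i, z, hz, rfl⟩ := h
    have hz0 : z.2 ≠ 0 := fun h0 => hp ((H.stripT_mem_arcs_iff hz).2 h0)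
    rw [ContinuousAt, H.pushOff_stripT hz, ← (H.isTube_stripT i).map_nhds z hz, tendsto_map'_iff]
    have h1 : Tendsto (push (H.f i)) (𝓝[band] z) (𝓝[band] (push (H.f i) z)) := by
      refine tendsto_nhdsWithin_iff.2 ⟨?_, ?_⟩
      · exact (continuousAt_push (H.f_smooth i).continuous hz0).mono_left nhdsWithin_le_nhds
      · filter_upwards [self_mem_nhdsWithin] with w hw using push_mem_band hw
    have h2 := ((H.isTube_stripT i).continuousOn _ (push_mem_band (f := H.f i) hz)).tendsto.comp h1
    refine h2.congr' ?_
    filter_upwards [self_mem_nhdsWithin] with w hw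
    exact (H.pushOff_stripT hw).symm
  · push Not at h
    have hM : ∀ i, ∃ M : ℝ, ∀ t ∈ Icc (0 : ℝ) 1, |H.f i t| ≤ M := fun i => by
      obtain ⟨M, hM⟩ := isCompact_Icc.exists_bound_of_continuousOn
        (H.f_smooth i).continuous.continuousOn (s := Icc (0 : ℝ) 1)
      exact ⟨M, fun t ht => by simpa using hM t ht⟩
    choose M hM using hM
    have hev : ∀ᶠ q in 𝓝 p, ∀ i, q ∉ H.stripT i '' (Icc 0 1 ×ˢ Icc (-(M i + 1)) (M i + 1)) := by
      rw [eventually_all]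
      intro i
      have hsub : Icc (0 : ℝ) 1 ×ˢ Icc (-(M i + 1)) (M i + 1) ⊆ band :=
        prod_mono_right (subset_univ _)
      have hc : IsClosed (H.stripT i '' (Icc 0 1 ×ˢ Icc (-(M i + 1)) (M i + 1))) :=
        ((isCompact_Icc.prod isCompact_Icc).image_of_continuousOn
          ((H.isTube_stripT i).continuousOn.mono hsub)).isClosed
      refine hc.isOpen_compl.mem_nhds ?_
      rintro ⟨z, hz, h'⟩
      exact h i z (hsub hz) h'
    have heq : H.pushOff =ᶠ[𝓝 p] id := by
      filter_upwards [hev] with q hq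
      by_cases h' : ∃ i, ∃ z ∈ band, H.stripT i z = q
      · obtain ⟨i, z, hz, rfl⟩ := h'
        rw [H.pushOff_stripT hz, push_eq_self (hM i z.1 (mem_band.1 hz)), id]
        by_contra hle
        refine hq i ⟨z, ⟨mem_band.1 hz, ?_⟩, rfl⟩
        exact abs_le.1 (not_lt.1 hle)
      · push Not at h'
        exact H.pushOff_of_forall h'
    exact continuousAt_id.congr heq.symm

variable {H}

/-- An outer point in a tube and its push lie on one vertical half-line beyond both the core and the
graph, and no curve crosses this half-line. -/
theorem mult_pushOff (D : H.Chain) {p : S} (hp : H.Outer p) :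
    mult D (Page.half.incl (H.pushOff p)) = mult D (Page.half.incl p) := by
  by_cases h : ∃ i, ∃ z ∈ band, H.stripT i z = p
  · obtain ⟨i, z, hz, rfl⟩ := h
    rw [H.pushOff_stripT hz]
    rw [H.outer_stripT_iff hz] at hp
    have key : ∀ I : Set ℝ, Convex ℝ I → (∀ x ∈ I, Beyond (H.f i) (z.1, x)) →
        ∀ x ∈ I, ∀ x' ∈ I, mult D (Page.half.incl (H.stripT i (z.1, x))) =
          mult D (Page.half.incl (H.stripT i (z.1, x'))) := by
      intro I hI hIb x hx x' hx'
      have hband : ∀ y : ℝ, (z.1, y) ∈ band := fun y => mem_band.2 (mem_band.1 hz)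
      refine constOff_mult D .half ((fun y => H.stripT i (z.1, y)) '' I) ?_ ?_ _
        ⟨x, hx, rfl⟩ _ ⟨x', hx', rfl⟩
      · refine hI.isPreconnected.image _ ?_
        exact (H.isTube_stripT i).continuousOn.comp (by fun_prop) fun y _ => hband y
      · rintro _ ⟨y, hy, rfl⟩
        exact H.not_mem_arcsOn_of_outer ((H.outer_stripT_iff (hband y)).2 (hIb y hy))
    have hz0 : z.2 ≠ 0 := by rcases hp with hp | hp <;> linarith [hp.1]
    have hb := beyond_push (f := H.f i) hz0
    have hpe : push (H.f i) z = (z.1, (push (H.f i) z).2) := Prod.ext (push_fst _ _) rfl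
    rw [hpe]
    rw [hpe] at hb
    rcases hp with hp | hp
    · refine key (Ioi 0 ∩ Ioi (H.f i z.1)) ((convex_Ioi _).inter (convex_Ioi _))
        (fun x hx => Or.inl hx) _ ?_ z.2 hp
      rcases hb with hb | hb
      · exact hb
      · exfalso
        have h1 := hb.1
        rw [push, if_pos hp.1] at h1
        exact absurd ((le_max_left _ _).trans_lt h1) (not_lt.2 hp.1.le)
    · refine key (Iio 0 ∩ Iio (H.f i z.1)) ((convex_Iio _).inter (convex_Iio _))
        (fun x hx => Or.inr hx) _ ?_ z.2 hp
      rcases hb with hb | hb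
      · exfalso
        have h1 := hb.1
        rw [push, if_neg (not_lt.2 hp.1.le)] at h1
        exact absurd (h1.trans_le (min_le_left _ _)) (not_lt.2 hp.1.le)
      · exact hb
  · push Not at h
    rw [H.pushOff_of_forall h]

theorem outer_of_mem_Z {z : S} (hz : z ∈ H.Z) : H.Outer z := by
  rintro i w hw rfl
  have h : w.2 ∉ uIcc 0 (H.f i w.1) := fun hs => H.Z_strip i w.1 (mem_band.1 hw) w.2 hs hz
  rw [mem_uIcc, not_or, not_and_or, not_and_or] at h
  simp only [not_le] at h
  rcases lt_trichotomy w.2 0 with h0 | h0 | h0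
  · exact Or.inr ⟨h0, by rcases h.2 with h2 | h2 <;> linarith⟩
  · exfalso
    rcases h.1 with h1 | h1 <;> rcases h.2 with h2 | h2 <;> linarith
  · exact Or.inl ⟨h0, by rcases h.1 with h2 | h2 <;> linarith⟩

/-- The component of `p` in the complement of the arcs contains a basepoint. Its image under
`pushOff` is connected and avoids all curves, while the push changes the multiplicity neither at `p`
nor at the basepoint. So both have the same multiplicity, which is 0. -/
theorem mult_of_outer [T2Space S] (D : H.Chain) {p : S} (hp : H.Outer p) :
    mult D (Page.half.incl p) = 0 := by
  have hpA : p ∈ B.arcsᶜ := fun h => H.not_mem_arcsOn_of_outer hp (Or.inl h)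
  obtain ⟨z, ⟨hzZ, hzC⟩, -⟩ := H.Z_component p hpA
  have hsub := connectedComponentIn_subset B.arcsᶜ p
  have hpre : IsPreconnected (H.pushOff '' connectedComponentIn B.arcsᶜ p) :=
    isPreconnected_connectedComponentIn.image _ (H.continuousOn_pushOff.mono hsub)
  rw [← mult_pushOff D hp, ← mult_of_mem_Z D hzZ, ← mult_pushOff D (outer_of_mem_Z hzZ)]
  refine constOff_mult D .half _ hpre ?_ _ ⟨p, mem_connectedComponentIn hpA, rfl⟩ _ ⟨z, hzC, rfl⟩
  rintro _ ⟨q, hq, rfl⟩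
  exact H.not_mem_arcsOn_of_outer (H.outer_pushOff (hsub hq))

variable (H)

theorem f_τ (i : Fin N) : H.f i (H.τ i) = 0 :=
  (H.f_zero i _ (Ioo_subset_Icc_self (H.τ_mem i))).2 rfl

theorem exists_sign_near_τ (i : Fin N) : ∃ ε > 0, ∀ δ ∈ Ioo 0 ε,
    0 < H.f i (H.τ i + δ) ∧ H.f i (H.τ i - δ) < 0 := by
  have hd : HasDerivAt (H.f i) (deriv (H.f i) (H.τ i)) (H.τ i) :=
    ((H.f_smooth i).differentiable (by simp) _).hasDerivAt
  have h0 := H.f_pos i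
  have h1 := eventually_sign_ray (x := (1 : ℝ)) hd.hasFDerivAt (H.f_τ i) (by simpa using h0.ne')
  have h2 := eventually_sign_ray (x := (-1 : ℝ)) hd.hasFDerivAt (H.f_τ i) (by simpa using h0.ne')
  obtain ⟨ε, hε, h⟩ := mem_nhdsGT_iff_exists_Ioo_subset.1 (h1.and h2)
  refine ⟨ε, hε, fun δ hδ => ?_⟩
  obtain ⟨h3, h4⟩ := h hδ
  simp only [smul_eq_mul, mul_one, mul_neg, ContinuousLinearMap.toSpanSingleton_apply, one_mul,
    neg_mul, sign_pos h0, Left.sign_neg] at h3 h4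
  constructor
  · exact sign_eq_one_iff.1 h3
  · exact sign_eq_neg_one_iff.1 h4

/-- The derivative gives the sign just after `τ`; a later change of sign would produce a second
zero. -/
theorem f_pos_of_gt {i : Fin N} {t : ℝ} (ht : t ∈ Icc (0 : ℝ) 1) (h : H.τ i < t) : 0 < H.f i t := by
  obtain ⟨ε, hε, hs⟩ := H.exists_sign_near_τ i
  have hδ : 0 < min (ε / 2) ((t - H.τ i) / 2) := lt_min (by positivity) (by linarith)
  have h1 := (hs _ ⟨hδ, (min_le_left _ _).trans_lt (half_lt_self hε)⟩).1
  have h2 := min_le_right (ε / 2) ((t - H.τ i) / 2)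
  set s := H.τ i + min (ε / 2) ((t - H.τ i) / 2) with hsdef
  by_contra hle
  have h0 := (H.τ_mem i).1
  obtain ⟨r, hr, hr0⟩ := intermediate_value_Icc' (by linarith : s ≤ t)
    (H.f_smooth i).continuous.continuousOn ⟨not_lt.1 hle, h1.le⟩
  have := (H.f_zero i r ⟨by linarith [hr.1], hr.2.trans ht.2⟩).1 hr0
  linarith [hr.1]

theorem f_neg_of_lt {i : Fin N} {t : ℝ} (ht : t ∈ Icc (0 : ℝ) 1) (h : t < H.τ i) : H.f i t < 0 := by
  obtain ⟨ε, hε, hs⟩ := H.exists_sign_near_τ i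
  have hδ : 0 < min (ε / 2) ((H.τ i - t) / 2) := lt_min (by positivity) (by linarith)
  have h1 := (hs _ ⟨hδ, (min_le_left _ _).trans_lt (half_lt_self hε)⟩).2
  have h2 := min_le_right (ε / 2) ((H.τ i - t) / 2)
  set s := H.τ i - min (ε / 2) ((H.τ i - t) / 2) with hsdef
  by_contra hle
  have h0 := (H.τ_mem i).2
  obtain ⟨r, hr, hr0⟩ := intermediate_value_Icc' (by linarith : t ≤ s)
    (H.f_smooth i).continuous.continuousOn ⟨h1.le, not_lt.1 hle⟩
  have := (H.f_zero i r ⟨ht.1.trans hr.1, by linarith [hr.2]⟩).1 hr0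
  linarith [hr.2]

variable {H}

/-- The multiplicity of `D` in the part of the thin strip after the contact point. -/
def multAfter (D : H.Chain) (i : Fin N) : ℤ :=
  -- The sample point is halfway across the strip at its end; by `mult_thin` any other point of this
  -- half would do.
  mult D (Page.half.incl (H.stripT i (1, 2⁻¹ * H.f i 1)))

/-- The multiplicity of `D` in the part of the thin strip before the contact point. -/
def multBefore (D : H.Chain) (i : Fin N) : ℤ :=
  mult D (Page.half.incl (H.stripT i (0, 2⁻¹ * H.f i 0)))

/-- The part of the thin strip over `I` is the image of the rectangle `I ×ˢ Ioo 0 1` under `(t, c) ↦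
(t, c * f t)`, hence connected, and it avoids the curves because `f` has no zero on `I`. -/
theorem mult_thin (D : H.Chain) (i : Fin N) {I : Set ℝ} (hI : Convex ℝ I)
    (hI1 : I ⊆ Icc 0 1) (hI0 : ∀ t ∈ I, H.f i t ≠ 0) {s t c d : ℝ} (hs : s ∈ I) (ht : t ∈ I)
    (hc : c ∈ Ioo (0 : ℝ) 1) (hd : d ∈ Ioo (0 : ℝ) 1) :
    mult D (Page.half.incl (H.stripT i (s, c * H.f i s))) =
      mult D (Page.half.incl (H.stripT i (t, d * H.f i t))) := by
  refine constOff_mult D .half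
    ((fun w : ℝ × ℝ => H.stripT i (w.1, w.2 * H.f i w.1)) '' (I ×ˢ Ioo 0 1)) ?_ ?_ _
    ⟨(s, c), ⟨hs, hc⟩, rfl⟩ _ ⟨(t, d), ⟨ht, hd⟩, rfl⟩
  · refine (hI.prod (convex_Ioo 0 1)).isPreconnected.image _ ?_
    have hf := (H.f_smooth i).continuous
    exact (H.isTube_stripT i).continuousOn.comp (by fun_prop) fun w hw => mem_band.2 (hI1 hw.1)
  · rintro _ ⟨w, ⟨hw1, hw2⟩, rfl⟩ hw
    have hw := (H.stripT_mem_arcsOn_half_iff (z := (w.1, w.2 * H.f i w.1))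
      (mem_band.2 (hI1 hw1))).1 hw
    have h0 := hI0 _ hw1
    rcases hw with hw | hw
    · exact (mul_ne_zero hw2.1.ne' h0) hw
    · have : w.2 = 1 := mul_right_cancel₀ h0 (by rw [one_mul]; exact hw)
      exact hw2.2.ne this

theorem mult_after (D : H.Chain) {i : Fin N} {z : ℝ × ℝ} (hz : z ∈ band) (h0 : 0 < z.2)
    (h1 : z.2 < H.f i z.1) : mult D (Page.half.incl (H.stripT i z)) = multAfter D i := by
  have hfz : 0 < H.f i z.1 := h0.trans h1
  have hτ : H.τ i < z.1 := by
    by_contra hle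
    rcases (not_lt.1 hle).lt_or_eq with h | h
    · exact absurd (H.f_neg_of_lt (mem_band.1 hz) h) (not_lt.2 hfz.le)
    · rw [h, H.f_τ] at hfz
      exact lt_irrefl _ hfz
  have := mult_thin D i (I := Icc 0 1 ∩ Ioi (H.τ i)) ((convex_Icc 0 1).inter (convex_Ioi _))
    inter_subset_left (fun t ht => (H.f_pos_of_gt ht.1 ht.2).ne') (s := z.1) (t := 1)
    (c := z.2 / H.f i z.1) (d := 2⁻¹) ⟨mem_band.1 hz, hτ⟩ ⟨by simp, (H.τ_mem i).2⟩
    ⟨div_pos h0 hfz, (div_lt_one hfz).2 h1⟩ (by norm_num)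
  rwa [div_mul_cancel₀ _ hfz.ne'] at this

theorem mult_before (D : H.Chain) {i : Fin N} {z : ℝ × ℝ} (hz : z ∈ band) (h0 : z.2 < 0)
    (h1 : H.f i z.1 < z.2) : mult D (Page.half.incl (H.stripT i z)) = multBefore D i := by
  have hfz : H.f i z.1 < 0 := h1.trans h0
  have hτ : z.1 < H.τ i := by
    by_contra hle
    rcases (not_lt.1 hle).lt_or_eq with h | h
    · exact absurd (H.f_pos_of_gt (mem_band.1 hz) h) (not_lt.2 hfz.le)
    · rw [← h, H.f_τ] at hfz
      exact lt_irrefl _ hfz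
  have := mult_thin D i (I := Icc 0 1 ∩ Iio (H.τ i)) ((convex_Icc 0 1).inter (convex_Iio _))
    inter_subset_left (fun t ht => (H.f_neg_of_lt ht.1 ht.2).ne) (s := z.1) (t := 0)
    (c := z.2 / H.f i z.1) (d := 2⁻¹) ⟨mem_band.1 hz, hτ⟩ ⟨by simp, (H.τ_mem i).1⟩
    ⟨div_pos_of_neg_of_neg h0 hfz, (div_lt_one_of_neg hfz).2 h1⟩ (by norm_num)
  rwa [div_mul_cancel₀ _ hfz.ne] at this

/-- A point off the curves is either outer, with multiplicity 0, or in one of the two halves of a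
thin strip. -/
theorem mult_half_eq [T2Space S] {D D' : H.Chain} (h1 : multAfter D = multAfter D')
    (h2 : multBefore D = multBefore D') (p : S) :
    mult D (Page.half.incl p) = mult D' (Page.half.incl p) := by
  by_cases hpΓ : p ∈ H.arcsOn .half
  · rw [mult_of_mem_arcsOn D _ hpΓ, mult_of_mem_arcsOn D' _ hpΓ]
  by_cases hp : H.Outer p
  · rw [mult_of_outer D hp, mult_of_outer D' hp]
  · simp only [Outer, not_forall] at hp
    obtain ⟨i, z, hz, rfl, hb⟩ := hp
    rw [H.stripT_mem_arcsOn_half_iff hz, not_or] at hpΓ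
    simp only [Beyond, not_or, not_and, not_lt] at hb
    rcases lt_or_gt_of_ne hpΓ.1 with h | h
    · have h' := lt_of_le_of_ne (hb.2 h) (Ne.symm hpΓ.2)
      rw [mult_before D hz h h', mult_before D' hz h h', h2]
    · have h' := lt_of_le_of_ne (hb.1 h) hpΓ.2
      rw [mult_after D hz h h', mult_after D' hz h h', h1]

end HeegaardChoice

/-! ### Local analysis at the contact points and at the crossings on $S_0$. -/

namespace HeegaardChoice

variable {S : Type*} [TopologicalSpace S] [ChartedSpace (EuclideanHalfSpace 2) S]
variable {N : ℕ} {B : OpenBookDiagram S N} {H : HeegaardChoice B}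

theorem HasMultAlong.eq_of_eventually {D : H.Chain} {P : Page} {p : S} {w : Plane} {n m : ℤ}
    (h : HasMultAlong D P p w n)
    (h' : ∀ᶠ ε : ℝ in 𝓝[>] 0,
      mult D (P.incl ((extChartAt (𝓡∂ 2) p).symm (extChartAt (𝓡∂ 2) p p + ε • w))) = m) :
    n = m := by
  obtain ⟨ε, h1, h2⟩ := (Eventually.and h h').exists
  exact h1.symm.trans h2

theorem a_eq_bOn_half (i : Fin N) : B.a i (H.τ i) = H.bOn .half i (H.τ i) := by
  rw [← H.strip_arc i _ (Ioo_subset_Icc_self (H.τ_mem i))]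
  simp [bOn, b, H.f_τ]

/-- In tube coordinates the velocities of $b_i$ and $a_i$ are $(1,f_i'(\tau_i))$ and $(1,0)$, with
determinant $-f_i'(\tau_i)$; the tube preserves orientation. -/
theorem det2_velocity_half_neg (i : Fin N) :
    det2 (velocity (H.bOn .half i) (H.τ i)) (velocity (B.a i) (H.τ i)) < 0 := by
  have hτ := H.τ_mem i
  rw [H.velocity_a i hτ, H.velocity_bOn .half i hτ]
  have hs : shear (H.f i) !₂[H.τ i, 0] = !₂[H.τ i, 0] := by simp [shear, H.f_τ]
  have hF := H.isSmoothTube_strip i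
  have hv : (!₂[H.τ i, 0] : Plane) 0 ∈ Ioo (0 : ℝ) 1 := by simpa using hτ
  have h1 : planeDeriv (H.bTube .half i) !₂[H.τ i, 0] e₀ =
      planeDeriv (H.strip i) !₂[H.τ i, 0] (shearL (deriv (H.f i) (H.τ i)) e₀) := by
    have := planeDeriv_shear (F := H.strip i) (v := !₂[H.τ i, 0]) (H.f_smooth i)
      (by rw [hs]; exact (hF.contMDiffAt _ hv).mdifferentiableAt one_ne_zero)
    rw [hs] at this
    rw [bTube, this]
    simp
  rw [h1, det2_map, shearL_apply]
  have h2 := mul_pos (hF.det_pos _ hv) (H.f_pos i)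
  simp only [det2, e₀]
  simpa using h2

/-- This decides which of the four sectors at the contact point a ray enters. The height in the tube
of $a_i$ tells the side of $a_i$; the height in the sheared tube, which is `z.2 - f`, tells the side
of $b_i$. -/
theorem eventually_contact_ray (i : Fin N) {x : Plane}
    (hu : det2 (velocity (B.a i) (H.τ i)) x ≠ 0)
    (hv : det2 (velocity (H.bOn .half i) (H.τ i)) x ≠ 0) :
    ∀ᶠ ε : ℝ in 𝓝[>] 0, ∃ z ∈ band,
      H.stripT i z = (extChartAt (𝓡∂ 2) (B.a i (H.τ i))).symm
        (extChartAt (𝓡∂ 2) (B.a i (H.τ i)) (B.a i (H.τ i)) + ε • x) ∧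
      SignType.sign z.2 = SignType.sign (det2 (velocity (B.a i) (H.τ i)) x) ∧
      SignType.sign (z.2 - H.f i z.1) =
        SignType.sign (det2 (velocity (H.bOn .half i) (H.τ i)) x) := by
  have hτ := H.τ_mem i
  have hτ' : (!₂[H.τ i, 0] : Plane) 0 ∈ Ioo (0 : ℝ) 1 := by simpa using hτ
  have hp : H.strip i !₂[H.τ i, 0] = B.a i (H.τ i) :=
    H.strip_arc i _ (Ioo_subset_Icc_self hτ)
  have hp' : H.bTube .half i !₂[H.τ i, 0] = B.a i (H.τ i) := by
    rw [a_eq_bOn_half, bOn_eq]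
  rw [H.velocity_a i hτ] at hu ⊢
  rw [H.velocity_bOn .half i hτ] at hv ⊢
  filter_upwards [(H.isSmoothTube_strip i).eventually_ray hτ' (by simp) hp hu,
    (H.isSmoothTube_bTube .half i).eventually_ray hτ' (by simp) hp' hv]
    with ε ⟨z, hz, hz1, hz2⟩ ⟨w, hw, hw1, hw2⟩
  have hzw : z = shear (H.f i) w :=
    (H.isSmoothTube_strip i).injOn hz (shear_mem hw) (hz1.trans hw1.symm)
  have h0 : z 0 = w 0 := by rw [hzw]; simp [shear]
  have h1 : z 1 = w 1 + H.f i (w 0) := by rw [hzw]; simp [shear]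
  refine ⟨(z 0, z 1), mem_band.2 hz, ?_, hz2, ?_⟩
  · rw [← hz1, stripT, eta_plane]
  · rw [← hw2]
    congr 1
    simp [h0, h1]

/-- The sectors of `v + u` and `-v - u` are the two halves of the thin strip; those of `v - u` and
`-v + u` are outer and have multiplicity 0. With `det2 v u < 0` the boundary coefficient becomes the
sum over the first two. -/
theorem contact_equation [T2Space S] {x y : Set (Double S)} {D : H.Chain} (hD : D ∈ H.piHat x y)
    (i : Fin N) : multAfter D i + multBefore D i =
      y.indicator 1 (H.contact i) - x.indicator 1 (H.contact i) := by
  have hτ := Ioo_subset_Icc_self (H.τ_mem i)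
  obtain ⟨c₁, c₂, ⟨m, n, hm, hn, hc₁⟩, ⟨m', n', hm', hn', hc₂⟩, hc⟩ :=
    hD .half i i (H.τ i) hτ (H.τ i) hτ (a_eq_bOn_half i)
  have hneg := det2_velocity_half_neg (H := H) i
  set u := velocity (B.a i) (H.τ i) with hu
  set v := velocity (H.bOn .half i) (H.τ i) with hv
  have hpos : 0 < det2 u v := by rw [det2_swap]; linarith
  have e1 : det2 u (v + u) = det2 u v := by simp [det2]; ring
  have e2 : det2 v (v + u) = det2 v u := by simp [det2]; ring
  have e3 : det2 u (v - u) = det2 u v := by simp [det2]; ring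
  have e4 : det2 v (v - u) = -det2 v u := by simp [det2]; ring
  have e5 : det2 u (-v + u) = -det2 u v := by simp [det2]; ring
  have e6 : det2 v (-v + u) = det2 v u := by simp [det2]; ring
  have e7 : det2 u (-v - u) = -det2 u v := by simp [det2]; ring
  have e8 : det2 v (-v - u) = -det2 v u := by simp [det2]; ring
  have e9 : det2 (-v) u = -det2 v u := by simp [det2]; ring
  have hmA : m = multAfter D i := by
    refine hm.eq_of_eventually ?_
    filter_upwards [eventually_contact_ray i (by rw [← hu, e1]; exact hpos.ne')
      (by rw [← hv, e2]; exact hneg.ne)] with ε ⟨z, hz, h1, h2, h3⟩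
    rw [← hu, e1, sign_pos hpos, sign_eq_one_iff] at h2
    rw [← hv, e2, sign_neg hneg, sign_eq_neg_one_iff] at h3
    rw [← h1]
    exact mult_after D hz h2 (by linarith)
  have hnB : n' = multBefore D i := by
    refine hn'.eq_of_eventually ?_
    filter_upwards [eventually_contact_ray i (by rw [← hu, e7]; exact (neg_neg_of_pos hpos).ne)
      (by rw [← hv, e8]; exact (neg_pos.2 hneg).ne')] with ε ⟨z, hz, h1, h2, h3⟩
    rw [← hu, e7, sign_neg (neg_neg_of_pos hpos), sign_eq_neg_one_iff] at h2
    rw [← hv, e8, sign_pos (neg_pos.2 hneg), sign_eq_one_iff] at h3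
    rw [← h1]
    exact mult_before D hz h2 (by linarith)
  have hn0 : n = 0 := by
    refine hn.eq_of_eventually ?_
    filter_upwards [eventually_contact_ray i (by rw [← hu, e3]; exact hpos.ne')
      (by rw [← hv, e4]; exact (neg_pos.2 hneg).ne')] with ε ⟨z, hz, h1, h2, h3⟩
    rw [← hu, e3, sign_pos hpos, sign_eq_one_iff] at h2
    rw [← hv, e4, sign_pos (neg_pos.2 hneg), sign_eq_one_iff] at h3
    rw [← h1]
    exact mult_of_outer D ((H.outer_stripT_iff hz).2 (Or.inl ⟨h2, by linarith⟩))
  have hm0 : m' = 0 := by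
    refine hm'.eq_of_eventually ?_
    filter_upwards [eventually_contact_ray i (by rw [← hu, e5]; exact (neg_neg_of_pos hpos).ne)
      (by rw [← hv, e6]; exact hneg.ne)] with ε ⟨z, hz, h1, h2, h3⟩
    rw [← hu, e5, sign_neg (neg_neg_of_pos hpos), sign_eq_neg_one_iff] at h2
    rw [← hv, e6, sign_neg hneg, sign_eq_neg_one_iff] at h3
    rw [← h1]
    exact mult_of_outer D ((H.outer_stripT_iff hz).2 (Or.inr ⟨h2, by linarith⟩))
  have hfin : y.indicator 1 (H.contact i) - x.indicator 1 (H.contact i) = -c₁ - c₂ := hc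
  rw [hfin, hc₁, hc₂, e9, sign_neg hneg, sign_pos (neg_pos.2 hneg), hn0, hm0, hmA, hnB]
  simp [Page.sign]

/-- On the boundary $\varphi(b_j)$ coincides with $b_j$, which meets the arcs only at the contact
point, at a time strictly between 0 and 1. -/
theorem crossing_interior (i j : Fin N) (p : S) (hi : p ∈ arcOf (H.strip i))
    (hj : p ∈ arcOf (H.bTube .zero j)) : p ∉ bd S := by
  intro hbd
  have hj' := H.mem_arcOf_bTube_of_mem_bd .zero .half j hbd hj
  obtain ⟨s, hs, rfl⟩ := hi
  obtain ⟨t, ht, h⟩ := hj'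
  have h' : H.stripT j (t, H.f j t) = H.stripT i (s, 0) := by
    refine Eq.trans ?_ h
    simp [stripT, bTube, shear]
  obtain ⟨rfl, h2⟩ := H.stripT_unique (mem_band.2 ht) (mem_band.2 hs) h'
  rw [Prod.mk.injEq] at h2
  have h3 := (H.f_zero j t ht).1 h2.2
  have h4 := ((H.isSmoothTube_strip j).mem_bd_core_iff hs).1 hbd
  have h5 := H.τ_mem j
  rcases h4 with h4 | h4 <;> linarith [h5.1, h5.2, h2.1]

theorem mem_Ioo_of_notMem_bd {F : Plane → S} (hF : IsSmoothTube F) {s : ℝ} (hs : s ∈ Icc (0 : ℝ) 1)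
    (h : F !₂[s, 0] ∉ bd S) : s ∈ Ioo (0 : ℝ) 1 := by
  rw [hF.mem_bd_core_iff hs, not_or] at h
  exact ⟨lt_of_le_of_ne hs.1 (Ne.symm h.1), lt_of_le_of_ne hs.2 h.2⟩

theorem eventually_mem_arcsOn_iff [T2Space S] (P : Page) {i j : Fin N} {p : S}
    (hi : p ∈ arcOf (H.strip i)) (hj : p ∈ arcOf (H.bTube P j)) :
    ∀ᶠ q in 𝓝 p, (q ∈ H.arcsOn P ↔ q ∈ arcOf (H.strip i) ∨ q ∈ arcOf (H.bTube P j)) := by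
  filter_upwards [eventually_mem_arcOf_imp H.isSmoothTube_strip p,
    eventually_mem_arcOf_imp (H.isSmoothTube_bTube P) p] with q h1 h2
  rw [mem_arcsOn_iff]
  constructor
  · rintro (⟨k, hk⟩ | ⟨k, hk⟩)
    · rw [H.arcOf_strip_disjoint i k p hi (h1 k hk)]
      exact Or.inl hk
    · rw [H.arcOf_bTube_disjoint P j k p hj (h2 k hk)]
      exact Or.inr hk
  · rintro (h | h)
    · exact Or.inl ⟨i, h⟩
    · exact Or.inr ⟨j, h⟩

/-- The difference of the multiplicities of two chains on the page `S_0`. -/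
def multDiff (D D' : H.Chain) (p : S) : ℤ := mult D (Page.zero.incl p) - mult D' (Page.zero.incl p)

theorem constOff_multDiff (D D' : H.Chain) : ConstOff (H.arcsOn .zero) (multDiff D D') :=
  fun X hX hXΓ p hp q hq => by
    have h1 := constOff_mult D .zero X hX hXΓ p hp q hq
    have h2 := constOff_mult D' .zero X hX hXΓ p hp q hq
    simp only at h1 h2
    rw [multDiff, multDiff, h1, h2]

theorem tendsto_ray (p : S) (w : Plane) :
    Tendsto (fun ε : ℝ => (extChartAt (𝓡∂ 2) p).symm (extChartAt (𝓡∂ 2) p p + ε • w)) (𝓝[>] 0)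
      (𝓝 p) := by
  have h1 : Tendsto (fun ε : ℝ => extChartAt (𝓡∂ 2) p p + ε • w) (𝓝[>] 0)
      (𝓝 (extChartAt (𝓡∂ 2) p p)) :=
    (Continuous.tendsto' (by fun_prop) _ _ (by simp)).mono_left nhdsWithin_le_nhds
  have h2 := continuousAt_extChartAt_symm (I := 𝓡∂ 2) p
  rw [ContinuousAt, extChartAt_to_inv] at h2
  exact h2.comp h1

/-- Both domains have the same coefficient of $\mathbf y-\mathbf x$ at `p`, so their difference has
coefficient 0. Written out over the four sectors, this is `balance`. -/
theorem exists_isCrossing [T2Space S] {x y : Set (Double S)} {D D' : H.Chain}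
    (hD : D ∈ H.piHat x y) (hD' : D' ∈ H.piHat x y) (i j : Fin N) (p : S)
    (hi : p ∈ arcOf (H.strip i)) (hj : p ∈ arcOf (H.bTube .zero j)) :
    ∃ (e : OpenPartialHomeomorph S (ℝ × ℝ)) (n : SignType → SignType → ℤ),
      IsCrossing (H.arcsOn .zero) (multDiff D D') e p n ∧
      (∀ᶠ q in 𝓝 p, ((e q).1 = 0 ↔ q ∈ arcOf (H.strip i))) ∧
      ∀ᶠ q in 𝓝 p, ((e q).2 = 0 ↔ q ∈ arcOf (H.bTube .zero j)) := by
  have hbd := crossing_interior i j p hi hj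
  have hΓ := eventually_mem_arcsOn_iff .zero hi hj
  obtain ⟨s, hs, hsp⟩ : ∃ s ∈ Icc (0 : ℝ) 1, H.strip i !₂[s, 0] = p := hi
  obtain ⟨t, ht, htp⟩ : ∃ t ∈ Icc (0 : ℝ) 1, H.bTube .zero j !₂[t, 0] = p := hj
  have hs' : s ∈ Ioo (0 : ℝ) 1 := mem_Ioo_of_notMem_bd (H.isSmoothTube_strip i) hs (hsp ▸ hbd)
  have ht' : t ∈ Ioo (0 : ℝ) 1 := mem_Ioo_of_notMem_bd (H.isSmoothTube_bTube .zero j) ht (htp ▸ hbd)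
  have hap : B.a i s = p := by rw [← H.strip_arc i s hs]; exact hsp
  have hab : B.a i s = H.bOn .zero j t := by rw [hap, bOn_eq]; exact htp.symm
  have hdet : det2 (velocity (H.bOn .zero j) t) (velocity (B.a i) s) ≠ 0 :=
    H.transverse i j s hs t ht hab
  obtain ⟨e, hpe, he0, he1, he2, hray⟩ := exists_crossing_coordinates (H.isSmoothTube_strip i)
    (H.isSmoothTube_bTube .zero j) (a := !₂[s, 0]) (b := !₂[t, 0]) (by simpa using hs') (by simp) hsp
    (by simpa using ht') (by simp) htp (H.velocity_a i hs') (H.velocity_bOn .zero j ht') hdet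
  have hΓe : ∀ᶠ q in 𝓝 p, (q ∈ H.arcsOn .zero ↔ (e q).1 = 0 ∨ (e q).2 = 0) := by
    filter_upwards [hΓ, he1, he2] with q h1 h2 h3
    rw [h1, h2, h3]
  obtain ⟨n, hn⟩ := exists_quadrant_values (constOff_multDiff D D') hpe he0 hΓe
  refine ⟨e, n, ⟨hpe, he0, hΓe, hn, ?_⟩, he1, he2⟩
  have hb := hD .zero i j s hs t ht hab
  have hb' := hD' .zero i j s hs t ht hab
  rw [hap] at hb hb'
  set u := velocity (B.a i) s with hu
  set v := velocity (H.bOn .zero j) t with hv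
  -- A point on the ray close to `p` identifies the quadrant value of the difference with the sector
  -- multiplicities in the two boundary conditions.
  have hval : ∀ σ τ : ℝ, σ ≠ 0 → τ ≠ 0 → ∀ w : Plane, w = σ • v + τ • u → ∀ m m' : ℤ,
      HasMultAlong D .zero p w m → HasMultAlong D' .zero p w m' →
      n (SignType.sign σ) (SignType.sign τ) = m - m' := by
    rintro σ τ hσ hτ w rfl m m' hm hm'
    obtain ⟨ε, ⟨h1, h2⟩, h3, h4, h5⟩ := ((hray σ τ hσ hτ).and
      (((tendsto_ray p (σ • v + τ • u)).eventually hn).and (Eventually.and hm hm'))).exists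
    rw [h1, h2, multDiff, h4, h5] at h3
    refine (h3 ?_ ?_).symm
    · rw [← sign_ne_zero, h1, sign_ne_zero]; exact hσ
    · rw [← sign_ne_zero, h2, sign_ne_zero]; exact hτ
  obtain ⟨c₁, c₂, ⟨m₁, m₂, h1, h2, hc₁⟩, ⟨m₃, m₄, h3, h4, hc₂⟩, hc⟩ := hb
  obtain ⟨d₁, d₂, ⟨k₁, k₂, g1, g2, hd₁⟩, ⟨k₃, k₄, g3, g4, hd₂⟩, hd⟩ := hb'
  have one : (1 : ℝ) ≠ 0 := one_ne_zero
  have mone : (-1 : ℝ) ≠ 0 := by norm_num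
  have q1 := hval 1 1 one one (v + u) (by simp) _ _ h1 g1
  have q2 := hval 1 (-1) one mone (v - u) (by simp [sub_eq_add_neg]) _ _ h2 g2
  have q3 := hval (-1) 1 mone one (-v + u) (by simp) _ _ h3 g3
  have q4 := hval (-1) (-1) mone mone (-v - u) (by simp [sub_eq_add_neg]) _ _ h4 g4
  simp only [sign_one, Left.sign_neg] at q1 q2 q3 q4
  rw [q1, q2, q3, q4]
  have e9 : det2 (-v) u = -det2 v u := by simp [det2]; ring
  rw [e9, Left.sign_neg] at hc₂ hd₂
  have heq : -c₁ - c₂ = -d₁ - d₂ := hc.symm.trans hd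
  rw [hc₁, hc₂, hd₁, hd₂] at heq
  rcases lt_or_gt_of_ne hdet with h | h
  · rw [sign_neg h] at heq
    simp [Page.sign] at heq
    linarith
  · rw [sign_pos h] at heq
    simp [Page.sign] at heq
    linarith

theorem isArcSystem [T2Space S] {x y : Set (Double S)} {D D' : H.Chain}
    (hD : D ∈ H.piHat x y) (hD' : D' ∈ H.piHat x y)
    (hhalf : ∀ p, mult D (Page.half.incl p) = mult D' (Page.half.incl p)) :
    IsArcSystem (H.arcsOn .zero) (multDiff D D') H.strip (H.bTube .zero) where
  left := H.isSmoothTube_strip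
  right := H.isSmoothTube_bTube .zero
  left_disjoint := H.arcOf_strip_disjoint
  right_disjoint := H.arcOf_bTube_disjoint .zero
  mem_iff := H.mem_arcsOn_iff .zero
  constOff := constOff_multDiff D D'
  crossing := exists_isCrossing hD hD'
  crossing_interior := crossing_interior
  eq_zero p hp _ := by
    have : (Page.zero.incl p : Double S) = Page.half.incl p := incl_eq_iff.2 (Or.inr ⟨rfl, hp⟩)
    rw [multDiff, this, hhalf, sub_self]

/-! ### Domains are determined by the thin strips, and the count. -/

theorem eq_of_mult_eq {D D' : H.Chain}
    (h : ∀ (P : Page) (p : S), mult D (P.incl p) = mult D' (P.incl p)) : D = D' := by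
  ext ⟨R, hR⟩
  obtain ⟨⟨q, hq⟩, rfl⟩ := ConnectedComponents.surjective_coe R
  have hmult : ∀ D : H.Chain, mult D q = D ⟨ConnectedComponents.mk ⟨q, hq⟩, hR⟩ := fun D => by
    rw [mult, dif_pos hq, dif_neg hR]
  have hPp : ∃ (P : Page) (p : S), P.incl p = q := by
    induction q using Quotient.inductionOn with
    | h z =>
      rcases z with p | p
      · exact ⟨.half, p, rfl⟩
      · exact ⟨.zero, p, rfl⟩
  obtain ⟨P, p, hp⟩ := hPp
  have := h P p
  rwa [hp, hmult, hmult] at this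

/-- Agreement on the thin strips gives agreement on $S_{1/2}$, hence on the gluing curve. The
difference on $S_0$ is then an arc system, which vanishes by the disk condition. -/
theorem eq_of_mem_piHat [T2Space S] [CompactSpace S] {x y : Set (Double S)} {D D' : H.Chain}
    (hD : D ∈ H.piHat x y) (hD' : D' ∈ H.piHat x y) (h1 : multAfter D = multAfter D')
    (h2 : multBefore D = multBefore D') : D = D' := by
  have hhalf := mult_half_eq h1 h2
  refine eq_of_mult_eq fun P p => ?_
  cases P
  · exact hhalf p
  · by_cases hp : p ∈ H.arcsOn .zero
    · rw [mult_of_mem_arcsOn D _ hp, mult_of_mem_arcsOn D' _ hp]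
    · refine sub_eq_zero.1 ((isArcSystem hD hD' hhalf).eq_zero_of_disks ?_ hp)
      rw [← H.arcs_eq]
      exact B.disks

theorem contact_injective : Function.Injective H.contact := by
  intro i j hij
  have h : B.a i (H.τ i) = B.a j (H.τ j) := by
    rcases incl_eq_iff.1 hij with h | h
    · exact h.2
    · exact h.1
  have hi := Ioo_subset_Icc_self (H.τ_mem i)
  have hj := Ioo_subset_Icc_self (H.τ_mem j)
  rw [← H.strip_arc i _ hi, ← H.strip_arc j _ hj] at h
  exact H.strip_index_unique (mk_mem hi) (mk_mem hj) h

theorem mult_nonneg {D : H.Chain} (hD : 0 ≤ D) (q : Double S) : 0 ≤ mult D q := by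
  unfold mult
  split_ifs
  · exact le_rfl
  · exact hD _
  · exact le_rfl

theorem encard_positive_le [T2Space S] [CompactSpace S] (x y : Set (Double S)) :
    {D | D ∈ H.piHat x y ∧ 0 ≤ D}.encard ≤ 2 ^ (range H.contact ∩ (y \ x)).ncard := by
  classical
  let K : Finset (Fin N) := Finset.univ.filter fun i => H.contact i ∈ y \ x
  have hcard : (range H.contact ∩ (y \ x)).ncard = K.card := by
    have : range H.contact ∩ (y \ x) = H.contact '' (K : Set (Fin N)) := by
      ext q
      constructor
      · rintro ⟨⟨i, rfl⟩, h⟩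
        exact ⟨i, by simpa [K] using h, rfl⟩
      · rintro ⟨i, hi, rfl⟩
        exact ⟨⟨i, rfl⟩, by simpa [K] using hi⟩
    rw [this, ncard_image_of_injective _ contact_injective, ncard_coe_finset]
  rw [hcard]
  -- Two non-negative integers with sum 1, 0 or -1: the first case leaves two options, the second
  -- one, the third none.
  have hvals : ∀ D, D ∈ H.piHat x y → 0 ≤ D → ∀ i,
      (i ∈ K → (multAfter D i = 1 ∧ multBefore D i = 0) ∨
        (multAfter D i = 0 ∧ multBefore D i = 1)) ∧
      (i ∉ K → multAfter D i = 0 ∧ multBefore D i = 0) := by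
    intro D hD h0 i
    have h1 := contact_equation hD i
    have h2 : 0 ≤ multAfter D i := mult_nonneg h0 _
    have h3 : 0 ≤ multBefore D i := mult_nonneg h0 _
    simp only [indicator_apply, Pi.one_apply] at h1
    constructor
    · intro hi
      have hi' : H.contact i ∈ y \ x := by simpa [K] using hi
      rw [if_pos hi'.1, if_neg hi'.2] at h1
      omega
    · intro hi
      have hi' : H.contact i ∉ y \ x := by simpa [K] using hi
      by_cases hy : H.contact i ∈ y
      · have hx : H.contact i ∈ x := by
          by_contra hx
          exact hi' ⟨hy, hx⟩
        rw [if_pos hy, if_pos hx] at h1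
        omega
      · rw [if_neg hy] at h1
        split_ifs at h1 <;> omega
  -- A positive domain is encoded by the contact points at which the multiplicity 1 sits after the
  -- point rather than before it; this is a subset of `K`.
  let Φ : H.Chain → Finset (Fin N) := fun D => Finset.univ.filter fun i => multAfter D i = 1
  have hmaps : MapsTo Φ {D | D ∈ H.piHat x y ∧ 0 ≤ D} (K.powerset : Set (Finset (Fin N))) := by
    rintro D ⟨hD, h0⟩
    simp only [Finset.mem_coe, Finset.mem_powerset]
    intro i hi
    have hi1 : multAfter D i = 1 := by simpa [Φ] using hi
    by_contra hiK
    have := ((hvals D hD h0 i).2 hiK).1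
    omega
  have hinj : InjOn Φ {D | D ∈ H.piHat x y ∧ 0 ≤ D} := by
    rintro D ⟨hD, h0⟩ D' ⟨hD', h0'⟩ hΦ
    have hiff : ∀ i, multAfter D i = 1 ↔ multAfter D' i = 1 := fun i => by
      simpa [Φ] using Finset.ext_iff.1 hΦ i
    have hboth : ∀ i, multAfter D i = multAfter D' i ∧ multBefore D i = multBefore D' i := by
      intro i
      have h1 := hvals D hD h0 i
      have h2 := hvals D' hD' h0' i
      have h3 := hiff i
      by_cases hi : i ∈ K
      · have h4 := h1.1 hi
        have h5 := h2.1 hi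
        omega
      · have h4 := h1.2 hi
        have h5 := h2.2 hi
        omega
    exact eq_of_mem_piHat hD hD' (funext fun i => (hboth i).1) (funext fun i => (hboth i).2)
  refine (encard_le_encard_of_injOn hmaps hinj).trans ?_
  rw [encard_coe_eq_coe_finsetCard, Finset.card_powerset]
  simp

end HeegaardChoice

end OpenBook

end

theorem mainTheorem2 {S : Type*} [TopologicalSpace S] [T2Space S] [CompactSpace S]
    [ChartedSpace (EuclideanHalfSpace 2) S] [IsManifold (𝓡∂ 2) ∞ S]
    (hS : OpenBook.IsOriented S) {N : ℕ} (B : OpenBook.OpenBookDiagram S N)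
    (H : OpenBook.HeegaardChoice B) (x y : Set (OpenBook.Double S))
    (hx : H.IsGenerator x) (hy : H.IsGenerator y) (hne : (H.piHat x y).Nonempty)
    (k : ℕ) (hk : k = (range H.contact ∩ (y \ x)).ncard) :
    {D | D ∈ H.piHat x y ∧ 0 ≤ D}.encard ≤ 2 ^ k := by
  rw [hk]
  exact OpenBook.HeegaardChoice.encard_positive_le x y
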